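/- **Definitions.** A *bigraph* $G=(U,W;E)$ consists of finite sets $U,W$ and $E\subseteq U\times W$. For $X\subseteq U$, $Y\subseteq W$ put $d_G(X,Y)=|E\cap(X\times Y)|/(|X||Y|)$ and $d_G=d_G(U,W)$. It is *$\epsilon$-regular* if $|d_G-d_G(X,Y)|\le\epsilon$ whenever $|X|\ge\epsilon|U|$ and $|Y|\ge\epsilon|W|$. It has $\mathrm{dev}_2(\epsilon,d)$ if $|d_G-d|\le\epsilon$ and $$\sum_{u_0,u_1\in U}\sum_{w_0,w_1\in W}\prod_{i,j\in\{0,1\}}g(u_i,w_j)\le\epsilon|U|^2|W|^2,$$ where $g=1-d_G$ on $E$ and $g=-d_G$ off $E$; it has $\mathrm{dev}_2(\epsilon)$ if it has $\mathrm{dev}_2(\epsilon,d_G)$. Let $U_{bg}(k)$ be the bigraph $(\mathcal P([k]),[k];\{(S,i):i\in S\})$. A *triad* $G=(X,Y,Z;E_{XY},E_{XZ},E_{YZ})$ consists of three bigraphs on $(X,Y)$, $(X,Z)$, $(Y,Z)$, and $K_3(G)$ is the set of $(x,y,z)\in X\times Y\times Z$ with $(x,y)\in E_{XY}$, $(x,z)\in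 E_{XZ}$, $(y,z)\in E_{YZ}$. Let $H$ be a $3$-graph ($3$-uniform hypergraph) on $V$, and let $X,Y,Z\subseteq V$. Let $\overline E=\{(x,y,z)\in V^3:\{x,y,z\}\in E(H)\}$ and let $d_H(G)=|\overline E\cap K_3(G)|/|K_3(G)|$. Let $h=1-d_H(G)$ on $\overline E\cap K_3(G)$, $h=-d_H(G)$ on $K_3(G)\setminus\overline E$, and $h=0$ off $K_3(G)$. Then $G$ has $\mathrm{dev}_{2,3}(\epsilon_1,\epsilon_2)$ with respect to $H$ if there are $d_{XY},d_{XZ},d_{YZ}>0$ such that the three component bigraphs have $\mathrm{dev}_2(\epsilon_2,d_{XY})$, $\mathrm{dev}_2(\epsilon_2,d_{XZ})$, $\mathrm{dev}_2(\epsilon_2,d_{YZ})$, respectively, and $$\sum_{x_0,x_1\in X}\sum_{y_0,y_1\in Y}\sum_{z_0,z_1\in Z}\prod_{i,j,k\in\{0,1\}}h(x_i,y_j,z_k)\le\epsilon_1d_{XY}^4d_{XZ}^4d_{YZ}^4|X|^2|Y|^2|Z|^2.$$ A *$(t,\ell)$-decomposition* of $V$ ($t,\ell\ge1$) is a partition $V=V_1\cup\dots\cup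 V_t$ with, for all $1\le i,j\le t$, a partition $V_i\times V_j=P_{ij}^1\cup\dots\cup P_{ij}^\ell$ (empty parts allowed). Its triads are the $(V_i,V_j,V_k;P_{ij}^\alpha,P_{ik}^\beta,P_{jk}^\gamma)$. It is a *$(t,\ell,\epsilon_1,\epsilon_2)$-decomposition* if at least $(1-\epsilon_1)|V|^2$ pairs in $V^2$ lie in some $P_{ij}^\alpha$ such that $(V_i,V_j;P_{ij}^\alpha)$ has $\mathrm{dev}_2(\epsilon_2)$. It is *$\mathrm{dev}_{2,3}(\epsilon_1,\epsilon_2)$-regular* with respect to $H$ if all but at most $\epsilon_1|V|^3$ triples in $V^3$ lie in $K_3(G)$ for some triad $G$ of it that has $\mathrm{dev}_{2,3}(\epsilon_1,\epsilon_2)$ with respect to $H$. A *bipartite $U$-colored graph* is $\Gamma=(A\cup B,(P_u)_{u\in U})$ where $A,B$ are disjoint and the $P_u$ partition the set of pairs $xy$ with $x\in A$, $y\in B$. An *$(m,\Gamma)$-blowup* of $(U,W;E)$ is a $3$-graph whose vertex set is the disjoint union of $A$, $B$ and sets $C_w$ ($w\in W$) with $|C_w|=m$, such that for all $u\in U$,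 $w\in W$, $xy\in P_u$ and $z\in C_w$, the triple $xyz$ is an edge if and only if $(u,w)\in E$ (all other triples are arbitrary). **Proposition.** There are constants $K_1,\epsilon^*>0$ such that for all $0<\epsilon_1<(\epsilon^*)^{K_1^2}$ there is $\epsilon_2^*:\mathbb N\to(0,1)$ such that for all $t\ge1$ and all $\epsilon_2:\mathbb N\to(0,1)$ with $\epsilon_2(x)<\epsilon_2^*(x)$ for all $x$, there is $\epsilon>0$ such that for all sufficiently large $n$ the following holds. Let $K=\lfloor\epsilon_1^{-1/K_1^2}\rfloor$ and suppose that $K$ divides $n$. Let $\Gamma=(A\cup B,(P_S)_{S\subseteq[K]})$ be a bipartite $\mathcal P([K])$-colored graph with $|A|=|B|=n$ such that for each $S\subseteq[K]$ the bigraph $(A,B;P_S)$ is $\epsilon$-regular and its density differs from $2^{-K}$ by at most $\epsilon$. Let $H$ be an $(n/K,\Gamma)$-blowup of $U_{bg}(K)$, let $\ell\ge1$, and let $\mathcal P$ be a $\mathrm{dev}_{2,3}(\epsilon_1^{K_1},\epsilon_2(\ell)^{K_1})$-regular $(t,\ell,\epsilon_1^{K_1},\epsilon_2(\ell)^{K_1})$-decomposition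 of $H$. Then $$\ell\ge 2^{\epsilon_1^{-1/(2K_1^2)}}.$$ -/

import Mathlib

namespace HypergraphRegularity

open Finset

/-! ### Bigraphs and their quasirandomness -/

/-- A bigraph `(V₁, V₂; E)`: two finite vertex sets and `E ⊆ V₁ × V₂`. -/
structure Bigraph (α β : Type*) where
  left : Finset α
  right : Finset β
  edges : Finset (α × β)
  edges_subset : edges ⊆ left ×ˢ right

namespace Bigraph

variable {α β : Type*} [DecidableEq α] [DecidableEq β]

/-- `d_G(X, Y) = |E ∩ (X × Y)| / (|X| |Y|)`. -/
noncomputable def densityOn (G : Bigraph α β) (X : Finset α) (Y : Finset β) : ℝ :=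
  (#(G.edges ∩ X ×ˢ Y) : ℝ) / ((#X : ℝ) * (#Y : ℝ))

/-- The density of the bigraph `G`. -/
noncomputable def density (G : Bigraph α β) : ℝ := G.densityOn G.left G.right

/-- The balanced function: `1 - d_G` on edges and `-d_G` on non-edges. -/
noncomputable def balanced (G : Bigraph α β) (u : α) (w : β) : ℝ :=
  if (u, w) ∈ G.edges then 1 - G.density else - G.density

/-- `G` has `dev₂(ε, d)`. -/
def HasDev2With (G : Bigraph α β) (ε d : ℝ) : Prop :=
  |G.density - d| ≤ ε ∧
  ∑ u₀ ∈ G.left, ∑ u₁ ∈ G.left, ∑ w₀ ∈ G.right, ∑ w₁ ∈ G.right,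
      G.balanced u₀ w₀ * G.balanced u₀ w₁ * G.balanced u₁ w₀ * G.balanced u₁ w₁
    ≤ ε * (#G.left : ℝ) ^ 2 * (#G.right : ℝ) ^ 2

/-- `G` has `dev₂(ε)`, i.e. `dev₂(ε, d_G)`. -/
def HasDev2 (G : Bigraph α β) (ε : ℝ) : Prop := G.HasDev2With ε G.density

/-- `ε`-regularity of a bipartite graph, here given with its ordered bipartition. -/
def IsEpsRegular (G : Bigraph α β) (ε : ℝ) : Prop :=
  ∀ A' ⊆ G.left, ∀ B' ⊆ G.right,
    ε * (#G.left : ℝ) ≤ (#A' : ℝ) → ε * (#G.right : ℝ) ≤ (#B' : ℝ) →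
      |G.density - G.densityOn A' B'| ≤ ε

end Bigraph

/-- The bigraph `U_bg(k)`: left vertices are the subsets `S ⊆ [k]`, right vertices are the
`i ∈ [k]`, and `(S, i)` is an edge iff `i ∈ S`. -/
def powersetBigraph (k : ℕ) : Bigraph (Finset (Fin k)) (Fin k) where
  left := univ
  right := univ
  edges := univ.filter fun p => p.2 ∈ p.1
  edges_subset := fun p _ => by simp

/-! ### Trigraphs and triads -/

/-- A trigraph `(X, Y, Z; E)` with `E ⊆ X × Y × Z`. -/
structure Trigraph (α β γ : Type*) where
  X : Finset α
  Y : Finset β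
  Z : Finset γ
  edges : Finset (α × β × γ)
  edges_subset : edges ⊆ X ×ˢ Y ×ˢ Z

/-- A triad `(X, Y, Z; E_XY, E_YZ, E_XZ)`, given by its three component bigraphs. -/
structure Triad (α β γ : Type*) where
  X : Finset α
  Y : Finset β
  Z : Finset γ
  EXY : Finset (α × β)
  EXZ : Finset (α × γ)
  EYZ : Finset (β × γ)
  EXY_subset : EXY ⊆ X ×ˢ Y
  EXZ_subset : EXZ ⊆ X ×ˢ Z
  EYZ_subset : EYZ ⊆ Y ×ˢ Z

namespace Triad

variable {α β γ : Type*}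

/-- The component bigraph `G[X, Y]`. -/
def bigraphXY (G : Triad α β γ) : Bigraph α β := ⟨G.X, G.Y, G.EXY, G.EXY_subset⟩

/-- The component bigraph `G[X, Z]`. -/
def bigraphXZ (G : Triad α β γ) : Bigraph α γ := ⟨G.X, G.Z, G.EXZ, G.EXZ_subset⟩

/-- The component bigraph `G[Y, Z]`. -/
def bigraphYZ (G : Triad α β γ) : Bigraph β γ := ⟨G.Y, G.Z, G.EYZ, G.EYZ_subset⟩

variable [DecidableEq α] [DecidableEq β] [DecidableEq γ]

/-- The set `K₃(G)` of ordered triangles of the triad `G`. -/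
def triangles (G : Triad α β γ) : Finset (α × β × γ) :=
  (G.X ×ˢ G.Y ×ˢ G.Z).filter fun p =>
    (p.1, p.2.1) ∈ G.EXY ∧ (p.2.1, p.2.2) ∈ G.EYZ ∧ (p.1, p.2.2) ∈ G.EXZ

end Triad

namespace Trigraph

variable {α β γ : Type*} [DecidableEq α] [DecidableEq β] [DecidableEq γ]

/-- The trigraph `H|G`, with the vertex sets of the triad `G` and edge set `E(H) ∩ K₃(G)`. -/
def restrict (H : Trigraph α β γ) (G : Triad α β γ) : Trigraph α β γ where
  X := G.X
  Y := G.Y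
  Z := G.Z
  edges := H.edges ∩ G.triangles
  edges_subset := inter_subset_right.trans (filter_subset _ _)

/-- The relative density `d_H(G) = |E(H) ∩ K₃(G)| / |K₃(G)|`. -/
noncomputable def relDensity (H : Trigraph α β γ) (G : Triad α β γ) : ℝ :=
  (#(H.edges ∩ G.triangles) : ℝ) / (#G.triangles : ℝ)

/-- The function `h_{H,G}`: it is `1 - d_H(G)` on edges of `H` in `K₃(G)`, `-d_H(G)` on the other
triangles of `G`, and `0` off `K₃(G)`. -/
noncomputable def balanced (H : Trigraph α β γ) (G : Triad α β γ) (x : α) (y : β) (z : γ) : ℝ :=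
  if (x, y, z) ∈ G.triangles then
    (if (x, y, z) ∈ H.edges then 1 - H.relDensity G else - H.relDensity G)
  else 0

/-- `(H, G)` has `dev_{2,3}(ε₁, ε₂)`, where `G` is a triad underlying `H`. -/
def HasDev23 (H : Trigraph α β γ) (G : Triad α β γ) (ε₁ ε₂ : ℝ) : Prop :=
  ∃ dXY dYZ dXZ : ℝ, 0 < dXY ∧ 0 < dYZ ∧ 0 < dXZ ∧
    G.bigraphXY.HasDev2With ε₂ dXY ∧
    G.bigraphXZ.HasDev2With ε₂ dXZ ∧
    G.bigraphYZ.HasDev2With ε₂ dYZ ∧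
    ∑ u₀ ∈ G.X, ∑ u₁ ∈ G.X, ∑ w₀ ∈ G.Y, ∑ w₁ ∈ G.Y, ∑ z₀ ∈ G.Z, ∑ z₁ ∈ G.Z,
        H.balanced G u₀ w₀ z₀ * H.balanced G u₀ w₀ z₁ *
        H.balanced G u₀ w₁ z₀ * H.balanced G u₀ w₁ z₁ *
        H.balanced G u₁ w₀ z₀ * H.balanced G u₁ w₀ z₁ *
        H.balanced G u₁ w₁ z₀ * H.balanced G u₁ w₁ z₁
      ≤ ε₁ * dXY ^ 4 * dYZ ^ 4 * dXZ ^ 4 *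
          (#G.X : ℝ) ^ 2 * (#G.Y : ℝ) ^ 2 * (#G.Z : ℝ) ^ 2

end Trigraph

/-! ### 3-graphs and regular decompositions -/

/-- A `3`-uniform hypergraph whose vertex set is the whole type `V`. -/
structure ThreeGraph (V : Type*) extends Hypergraph V where
  vertexSet_eq : vertexSet = Set.univ
  uniform : ∀ e ∈ edgeSet, e.ncard = 3

open Classical in
/-- The trigraph of ordered triples `(x, y, z)` whose underlying set is an edge of `H`. -/
noncomputable def ThreeGraph.toTrigraph {V : Type*} [Fintype V] (H : ThreeGraph V) :
    Trigraph V V V where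
  X := univ
  Y := univ
  Z := univ
  edges := univ.filter fun p => ({p.1, p.2.1, p.2.2} : Set V) ∈ H.edgeSet
  edges_subset := fun p _ => by simp

/-- A `(t, ℓ)`-decomposition of the vertex set `V`: a partition `V = V₁ ∪ ... ∪ V_t`, and for all
`i, j` (including `i = j`) a partition of `V_i × V_j` into `ℓ` pieces.  Classes may be empty. -/
structure Decomposition (V : Type*) [DecidableEq V] (t ℓ : ℕ) where
  cls : Fin t → Finset V
  cls_disjoint : ∀ i j, i ≠ j → Disjoint (cls i) (cls j)
  cls_cover : ∀ x, ∃ i, x ∈ cls i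
  piece : Fin t → Fin t → Fin ℓ → Finset (V × V)
  piece_disjoint : ∀ i j a b, a ≠ b → Disjoint (piece i j a) (piece i j b)
  piece_cover : ∀ i j, univ.biUnion (piece i j) = cls i ×ˢ cls j

namespace Decomposition

variable {V : Type*} [DecidableEq V] {t ℓ : ℕ}

theorem piece_subset (P : Decomposition V t ℓ) (i j : Fin t) (a : Fin ℓ) :
    P.piece i j a ⊆ P.cls i ×ˢ P.cls j :=
  P.piece_cover i j ▸ subset_biUnion_of_mem (P.piece i j) (mem_univ a)

/-- The bigraph `(V_i, V_j; P_{ij}^a)`. -/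
def bigraph (P : Decomposition V t ℓ) (i j : Fin t) (a : Fin ℓ) : Bigraph V V :=
  ⟨P.cls i, P.cls j, P.piece i j a, P.piece_subset i j a⟩

/-- The triad `(V_i, V_j, V_k; P_{ij}^a, P_{ik}^b, P_{jk}^c)` of the decomposition. -/
def triad (P : Decomposition V t ℓ) (i j k : Fin t) (a b c : Fin ℓ) : Triad V V V where
  X := P.cls i
  Y := P.cls j
  Z := P.cls k
  EXY := P.piece i j a
  EXZ := P.piece i k b
  EYZ := P.piece j k c
  EXY_subset := P.piece_subset i j a
  EXZ_subset := P.piece_subset i k b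
  EYZ_subset := P.piece_subset j k c

variable [Fintype V]

open Classical in
/-- The condition that makes a `(t, ℓ)`-decomposition a `(t, ℓ, ε₁, ε₂)`-decomposition: at least
`(1 - ε₁)|V|²` pairs lie in a piece which has `dev₂(ε₂)`. -/
def IsQuasirandom (P : Decomposition V t ℓ) (ε₁ ε₂ : ℝ) : Prop :=
  (1 - ε₁) * (Fintype.card V : ℝ) ^ 2 ≤
    (#(univ.filter fun p : V × V =>
      ∃ i j a, p ∈ P.piece i j a ∧ (P.bigraph i j a).HasDev2 ε₂) : ℝ)

open Classical in
/-- The decomposition is `dev_{2,3}(ε₁, ε₂)`-regular with respect to `H`: all but at most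
`ε₁|V|³` triples lie in `K₃(G)` for some triad `G` of it such that `(H|G, G)` has
`dev_{2,3}(ε₁, ε₂)`. -/
def IsRegular (P : Decomposition V t ℓ) (H : ThreeGraph V) (ε₁ ε₂ : ℝ) : Prop :=
  (#(univ.filter fun p : V × V × V =>
      ¬ ∃ i j k a b c, p ∈ (P.triad i j k a b c).triangles ∧
        (H.toTrigraph.restrict (P.triad i j k a b c)).HasDev23 (P.triad i j k a b c) ε₁ ε₂) : ℝ)
    ≤ ε₁ * (Fintype.card V : ℝ) ^ 3

end Decomposition

/-! ### Blowups -/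

/-- A bipartite `U`-colored graph `(A ∪ B, (P_u)_{u ∈ U})` inside a vertex type `V`.  As `A` and
`B` are disjoint, the pair `xy` with `x ∈ A`, `y ∈ B` is recorded as `(x, y)`. -/
structure ColoredBipartite (V : Type*) [DecidableEq V] {κ : Type*} (U : Finset κ) where
  A : Finset V
  B : Finset V
  disjoint_AB : Disjoint A B
  P : κ → Finset (V × V)
  P_subset : ∀ u, P u ⊆ A ×ˢ B
  P_disjoint : ∀ u ∈ U, ∀ v ∈ U, u ≠ v → Disjoint (P u) (P v)
  P_cover : U.biUnion P = A ×ˢ B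

/-- The bipartite graph `(A ∪ B, P_u)` formed by one color. -/
def ColoredBipartite.bigraph {V : Type*} [DecidableEq V] {κ : Type*} {U : Finset κ}
    (Γ : ColoredBipartite V U) (u : κ) : Bigraph V V :=
  ⟨Γ.A, Γ.B, Γ.P u, Γ.P_subset u⟩

/-- `H` is an `(m, Γ)`-blowup of the bigraph `G = (U, W; E)`: its vertex set is the disjoint union
of `A`, `B` and sets `C_w` (`w ∈ W`) of size `m`; for `xy ∈ P_u` and `z ∈ C_w` the triple `xyz` is
an edge of `H` if `(u, w) ∈ E` and a non-edge if `(u, w) ∉ E`.  Nothing else is prescribed. -/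
def IsBlowup {V : Type*} [Fintype V] [DecidableEq V] {κ ω : Type*} (G : Bigraph κ ω) (m : ℕ)
    (Γ : ColoredBipartite V G.left) (H : ThreeGraph V) : Prop :=
  ∃ C : ω → Finset V,
    (∀ w ∈ G.right, #(C w) = m) ∧
    (∀ w ∈ G.right, ∀ w' ∈ G.right, w ≠ w' → Disjoint (C w) (C w')) ∧
    (∀ w ∈ G.right, Disjoint (C w) (Γ.A ∪ Γ.B)) ∧
    Γ.A ∪ Γ.B ∪ G.right.biUnion C = univ ∧
    (∀ u ∈ G.left, ∀ w ∈ G.right, ∀ x y z, (x, y) ∈ Γ.P u → z ∈ C w →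
      (({x, y, z} : Set V) ∈ H.edgeSet ↔ (u, w) ∈ G.edges))

end HypergraphRegularity

/-!
Suppose that `ℓ < 2 ^ √D`, where `ε₁ = D⁻¹ ^ 9` and `K = ⌊D⌋₊`; the constants are `K₁ = 3` and
`10⁻⁴` for the bound on `D⁻¹`. Write `S(x, y) ⊆ [K]` for the color of a pair `(x, y) ∈ A × B`. For
`z ∈ C_w`, the triple `(x, y, z)` is an edge of `H` exactly when `w ∈ S(x, y)`.

*Regular triads predict the edges of the blowup.* Let `h` be the balanced function of
`H` on a regular triad. Three applications of the Cauchy–Schwarz inequality (`sum_pow_eight_le`)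
bound the correlation of `h` with a product of functions of two variables. The quasirandomness of
the component bigraphs enters only through upper bounds for their numbers of four-cycles, and it
makes this bound small relative to the number of triangles
(`Trigraph.HasDev23.abs_sum_balanced_le`). For fixed `w`, membership of `w` in `S(x, y)` does not
involve `z`, so the bound applies to the triangles on which the edge relation of `H` differs from
what the density of `H` on the triad suggests (edge if it is at least `1 / 2`, non-edge
otherwise). Hence this prediction is wrong for few triples
(`Decomposition.card_mispredicted_le`). Triads with a sparse component contain few triples in
total because `ε₂` may be taken small in terms of `ℓ`, so all but few triples of
`A × B × ⋃ C_w` are predicted correctly (`Decomposition.card_bad_le`).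

*Predictions determine colors approximately.* Averaging gives vertices `z_w ∈ C_w` such that for
at least half of the pairs `(x, y) ∈ A × B` the predictions for the triples `(x, y, z_w)` are wrong
for at most `K / 10` of the `w`. For such a pair, these predictions form a set at Hamming distance
at most `K / 10` from `S(x, y)`. This set depends only on the piece of `(x, y)`, one of `ℓ`
possibilities, and on labels of `x` and of `y`: the class of the vertex and the pieces of its pairs
with the `z_w`.

*Counting.* Since `ℓ < 2 ^ √D`, the number of labels is bounded in terms of `t` and `ε₁`, so
`ε`-regularity with small `ε` spreads every color uniformly over the cells of the labelling
(`card_close_to_guess_le`). Thus half of the pairs is at most about a fraction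
`ℓ · b · 2 ^ (-K)` of all of them, where `b` is the number of subsets of `[K]` of size at most
`K / 10` (`two_pow_le_mul_smallSubsets`). As `b ^ 10 ≤ 2 ^ (7 K)`, this forces
`ℓ ≥ 2 ^ (3 K / 10 - 2)`, which exceeds `2 ^ √D` (`two_rpow_sqrt_le`).
-/

namespace HypergraphRegularity

open Finset

section

variable {α β γ : Type*}

/-! ### Four-cycle sums and octahedron sums -/

theorem sq_sum₂_mul_le (X : Finset α) (Y : Finset β) (f g : α → β → ℝ) :
    (∑ x ∈ X, ∑ y ∈ Y, f x y * g x y) ^ 2 ≤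
      (∑ x ∈ X, ∑ y ∈ Y, f x y ^ 2) * ∑ x ∈ X, ∑ y ∈ Y, g x y ^ 2 := by
  simp only [← Finset.sum_product']
  exact Finset.sum_mul_sq_le_sq_mul_sq _ _ _

theorem sum_sq_sum_eq (X : Finset α) (Y : Finset β) (f : α → β → ℝ) :
    ∑ x ∈ X, (∑ y ∈ Y, f x y) ^ 2 = ∑ y₀ ∈ Y, ∑ y₁ ∈ Y, ∑ x ∈ X, f x y₀ * f x y₁ := by
  simp only [sq, Finset.sum_mul_sum]
  rw [Finset.sum_comm]
  exact Finset.sum_congr rfl fun _ _ => Finset.sum_comm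

/-- The octahedron sum of a function of three variables: the sum of the products of `h` over the
eight triples of `{x₀, x₁} × {y₀, y₁} × {z₀, z₁}`. -/
def octahedronSum (X : Finset α) (Y : Finset β) (Z : Finset γ) (h : α → β → γ → ℝ) : ℝ :=
  ∑ x₀ ∈ X, ∑ x₁ ∈ X, ∑ y₀ ∈ Y, ∑ y₁ ∈ Y, ∑ z₀ ∈ Z, ∑ z₁ ∈ Z,
    h x₀ y₀ z₀ * h x₀ y₀ z₁ * h x₀ y₁ z₀ * h x₀ y₁ z₁ *
    h x₁ y₀ z₀ * h x₁ y₀ z₁ * h x₁ y₁ z₀ * h x₁ y₁ z₁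

/-- The four-cycle sum of a function of two variables: the sum of the products of `f` over the
four pairs of `{x₀, x₁} × {y₀, y₁}`. -/
def fourCycleSum (X : Finset α) (Y : Finset β) (f : α → β → ℝ) : ℝ :=
  ∑ x₀ ∈ X, ∑ x₁ ∈ X, ∑ y₀ ∈ Y, ∑ y₁ ∈ Y, f x₀ y₀ * f x₀ y₁ * f x₁ y₀ * f x₁ y₁

theorem fourCycleSum_eq_left (X : Finset α) (Y : Finset β) (f : α → β → ℝ) :
    fourCycleSum X Y f = ∑ x₀ ∈ X, ∑ x₁ ∈ X, (∑ y ∈ Y, f x₀ y * f x₁ y) ^ 2 := by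
  unfold fourCycleSum
  simp only [sq, Finset.sum_mul_sum]
  refine sum_congr rfl fun _ _ => sum_congr rfl fun _ _ => sum_congr rfl fun _ _ =>
    sum_congr rfl fun _ _ => by ring

theorem fourCycleSum_eq_right (X : Finset α) (Y : Finset β) (f : α → β → ℝ) :
    fourCycleSum X Y f = ∑ y₀ ∈ Y, ∑ y₁ ∈ Y, (∑ x ∈ X, f x y₀ * f x y₁) ^ 2 := by
  have h1 : fourCycleSum X Y f = ∑ p ∈ X ×ˢ X, (∑ y ∈ Y, f p.1 y * f p.2 y) ^ 2 := by
    rw [fourCycleSum_eq_left, Finset.sum_product]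
  rw [h1, sum_sq_sum_eq]
  refine sum_congr rfl fun _ _ => sum_congr rfl fun _ _ => ?_
  rw [sq, Finset.sum_mul_sum, Finset.sum_product]
  refine sum_congr rfl fun _ _ => sum_congr rfl fun _ _ => by ring

theorem fourCycleSum_nonneg (X : Finset α) (Y : Finset β) (f : α → β → ℝ) :
    0 ≤ fourCycleSum X Y f := by
  rw [fourCycleSum_eq_left]; positivity

/-- The square of the mixed product `aᵀ b` is controlled by the four-cycle sums of `a` and `b`. -/
theorem sum_sq_mixed_le (X : Finset α) (Y : Finset β) (a b : α → β → ℝ) :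
    ∑ x₀ ∈ X, ∑ x₁ ∈ X, (∑ y ∈ Y, a x₀ y * b x₁ y) ^ 2 ≤
      (fourCycleSum X Y a + fourCycleSum X Y b) / 2 := by
  have h1 : ∑ x₀ ∈ X, ∑ x₁ ∈ X, (∑ y ∈ Y, a x₀ y * b x₁ y) ^ 2 =
      ∑ y₀ ∈ Y, ∑ y₁ ∈ Y, (∑ x ∈ X, a x y₀ * a x y₁) * ∑ x ∈ X, b x y₀ * b x y₁ := by
    rw [← Finset.sum_product' X X fun x₀ x₁ => (∑ y ∈ Y, a x₀ y * b x₁ y) ^ 2,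
      sum_sq_sum_eq]
    refine sum_congr rfl fun _ _ => sum_congr rfl fun _ _ => ?_
    rw [Finset.sum_mul_sum, Finset.sum_product]
    refine sum_congr rfl fun _ _ => sum_congr rfl fun _ _ => by ring
  rw [h1, fourCycleSum_eq_right, fourCycleSum_eq_right, ← Finset.sum_add_distrib,
    Finset.sum_div]
  refine sum_le_sum fun y₀ _ => ?_
  rw [← Finset.sum_add_distrib, Finset.sum_div]
  refine sum_le_sum fun y₁ _ => ?_
  linarith [two_mul_le_add_sq (∑ x ∈ X, a x y₀ * a x y₁) (∑ x ∈ X, b x y₀ * b x y₁)]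

/-- A quasi-triangle inequality for the four-cycle norm. -/
theorem fourCycleSum_add_le (X : Finset α) (Y : Finset β) (a b : α → β → ℝ) :
    fourCycleSum X Y (fun x y => a x y + b x y) ≤
      8 * (fourCycleSum X Y a + fourCycleSum X Y b) := by
  have key : fourCycleSum X Y (fun x y => a x y + b x y) ≤
      4 * (fourCycleSum X Y a + fourCycleSum X Y b
        + ∑ x₀ ∈ X, ∑ x₁ ∈ X, (∑ y ∈ Y, a x₀ y * b x₁ y) ^ 2
        + ∑ x₀ ∈ X, ∑ x₁ ∈ X, (∑ y ∈ Y, b x₀ y * a x₁ y) ^ 2) := by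
    simp only [fourCycleSum_eq_left, ← Finset.sum_add_distrib, Finset.mul_sum]
    refine sum_le_sum fun x₀ _ => sum_le_sum fun x₁ _ => ?_
    have : ∑ y ∈ Y, (a x₀ y + b x₀ y) * (a x₁ y + b x₁ y) =
        ∑ y ∈ Y, a x₀ y * a x₁ y + ∑ y ∈ Y, b x₀ y * b x₁ y + ∑ y ∈ Y, a x₀ y * b x₁ y
          + ∑ y ∈ Y, b x₀ y * a x₁ y := by
      simp only [← Finset.sum_add_distrib]
      exact sum_congr rfl fun _ _ => by ring
    rw [this]
    generalize ∑ y ∈ Y, a x₀ y * a x₁ y = p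
    generalize ∑ y ∈ Y, b x₀ y * b x₁ y = q
    generalize ∑ y ∈ Y, a x₀ y * b x₁ y = r
    generalize ∑ y ∈ Y, b x₀ y * a x₁ y = s
    nlinarith [sq_nonneg (p - q), sq_nonneg (p - r), sq_nonneg (p - s), sq_nonneg (q - r),
      sq_nonneg (q - s), sq_nonneg (r - s)]
  linarith [sum_sq_mixed_le X Y a b, sum_sq_mixed_le X Y b a]

theorem fourCycleSum_mono (X : Finset α) (Y : Finset β) {f g : α → β → ℝ}
    (hf : ∀ x y, 0 ≤ f x y) (hfg : ∀ x ∈ X, ∀ y ∈ Y, f x y ≤ g x y) :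
    fourCycleSum X Y f ≤ fourCycleSum X Y g := by
  have hg : ∀ x ∈ X, ∀ y ∈ Y, 0 ≤ g x y := fun x hx y hy => (hf x y).trans (hfg x hx y hy)
  rw [fourCycleSum_eq_left, fourCycleSum_eq_left]
  refine sum_le_sum fun x₀ h₀ => sum_le_sum fun x₁ h₁ => ?_
  refine pow_le_pow_left₀ (sum_nonneg fun y _ => mul_nonneg (hf _ _) (hf _ _)) ?_ 2
  exact sum_le_sum fun y hy =>
    mul_le_mul (hfg _ h₀ _ hy) (hfg _ h₁ _ hy) (hf _ _) (hg _ h₀ _ hy)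

/-- The number of cherries is controlled by the number of four-cycles. -/
theorem sq_cherrySum_le (X : Finset α) (Y : Finset β) (f : α → β → ℝ) :
    (∑ x ∈ X, ∑ y₀ ∈ Y, ∑ y₁ ∈ Y, f x y₀ * f x y₁) ^ 2 ≤ (#Y : ℝ) ^ 2 * fourCycleSum X Y f := by
  have h : ∑ x ∈ X, ∑ y₀ ∈ Y, ∑ y₁ ∈ Y, f x y₀ * f x y₁ =
      ∑ y₀ ∈ Y, ∑ y₁ ∈ Y, 1 * ∑ x ∈ X, f x y₀ * f x y₁ := by
    rw [Finset.sum_comm]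
    refine sum_congr rfl fun _ _ => ?_
    rw [Finset.sum_comm]
    simp
  rw [h, fourCycleSum_eq_right]
  refine (sq_sum₂_mul_le Y Y _ _).trans_eq ?_
  simp [sq]

/-! ### The Gowers–Cauchy–Schwarz inequality -/

/-- Gowers' Cauchy–Schwarz inequality for the octahedron sum, keeping track of the sizes of the
three functions of two variables. The inequality is applied to sums over `(x, y)`, over
`(x, z₀, z₁)` and over `(y₀, y₁, z₀, z₁)`; each step removes one of the three functions. -/
theorem sum_pow_eight_le (X : Finset α) (Y : Finset β) (Z : Finset γ) (h : α → β → γ → ℝ)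
    (u : α → β → ℝ) (v : α → γ → ℝ) (w : β → γ → ℝ) :
    (∑ x ∈ X, ∑ y ∈ Y, ∑ z ∈ Z, h x y z * (u x y * v x z * w y z)) ^ 8 ≤
      (∑ x ∈ X, ∑ y ∈ Y, u x y ^ 2) ^ 4 *
        (#Z ^ 2 * fourCycleSum X Z fun x z => v x z ^ 2) *
        (fourCycleSum Y Z fun y z => w y z ^ 2) * octahedronSum X Y Z h := by
  set S := ∑ x ∈ X, ∑ y ∈ Y, ∑ z ∈ Z, h x y z * (u x y * v x z * w y z) with hS
  set U := ∑ x ∈ X, ∑ y ∈ Y, u x y ^ 2 with hU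
  set S₁ := ∑ x ∈ X, ∑ y ∈ Y, (∑ z ∈ Z, h x y z * (v x z * w y z)) ^ 2 with hS₁
  have e₁ : S ^ 2 ≤ U * S₁ := by
    have : S = ∑ x ∈ X, ∑ y ∈ Y, u x y * ∑ z ∈ Z, h x y z * (v x z * w y z) := by
      simp only [hS, Finset.mul_sum]
      refine sum_congr rfl fun _ _ => sum_congr rfl fun _ _ => sum_congr rfl fun _ _ => by ring
    rw [this]
    exact sq_sum₂_mul_le X Y _ _
  set S₂ := ∑ x ∈ X, ∑ p ∈ Z ×ˢ Z,
    (∑ y ∈ Y, h x y p.1 * h x y p.2 * (w y p.1 * w y p.2)) ^ 2 with hS₂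
  set C := ∑ x ∈ X, ∑ z₀ ∈ Z, ∑ z₁ ∈ Z, v x z₀ ^ 2 * v x z₁ ^ 2 with hC
  have e₂ : S₁ ^ 2 ≤ C * S₂ := by
    have h1 : S₁ = ∑ x ∈ X, ∑ p ∈ Z ×ˢ Z,
        (v x p.1 * v x p.2) * ∑ y ∈ Y, h x y p.1 * h x y p.2 * (w y p.1 * w y p.2) := by
      simp only [hS₁]
      refine sum_congr rfl fun x _ => ?_
      rw [sum_sq_sum_eq, Finset.sum_product]
      refine sum_congr rfl fun _ _ => sum_congr rfl fun _ _ => ?_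
      rw [Finset.mul_sum]
      exact sum_congr rfl fun _ _ => by ring
    have h2 : C = ∑ x ∈ X, ∑ p ∈ Z ×ˢ Z, (v x p.1 * v x p.2) ^ 2 := by
      simp only [hC, Finset.sum_product, mul_pow]
    rw [h1, h2]
    exact sq_sum₂_mul_le X (Z ×ˢ Z) _ _
  set F := fourCycleSum Y Z fun y z => w y z ^ 2 with hF
  have e₃ : S₂ ^ 2 ≤ F * octahedronSum X Y Z h := by
    have h1 : S₂ = ∑ q ∈ Y ×ˢ Y, ∑ p ∈ Z ×ˢ Z,
        (w q.1 p.1 * w q.1 p.2 * w q.2 p.1 * w q.2 p.2) *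
          ∑ x ∈ X, h x q.1 p.1 * h x q.1 p.2 * h x q.2 p.1 * h x q.2 p.2 := by
      rw [hS₂, Finset.sum_comm, Finset.sum_comm (s := Y ×ˢ Y)]
      refine sum_congr rfl fun p _ => ?_
      rw [sum_sq_sum_eq, Finset.sum_product]
      refine sum_congr rfl fun _ _ => sum_congr rfl fun _ _ => ?_
      rw [Finset.mul_sum]
      exact sum_congr rfl fun _ _ => by ring
    have h2 : F = ∑ q ∈ Y ×ˢ Y, ∑ p ∈ Z ×ˢ Z,
        (w q.1 p.1 * w q.1 p.2 * w q.2 p.1 * w q.2 p.2) ^ 2 := by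
      simp only [hF, fourCycleSum, Finset.sum_product, mul_pow]
    have h3 : octahedronSum X Y Z h = ∑ q ∈ Y ×ˢ Y, ∑ p ∈ Z ×ˢ Z,
        (∑ x ∈ X, h x q.1 p.1 * h x q.1 p.2 * h x q.2 p.1 * h x q.2 p.2) ^ 2 := by
      rw [← Finset.sum_product' (Y ×ˢ Y) (Z ×ˢ Z) fun q p =>
        (∑ x ∈ X, h x q.1 p.1 * h x q.1 p.2 * h x q.2 p.1 * h x q.2 p.2) ^ 2, sum_sq_sum_eq]
      unfold octahedronSum
      simp only [Finset.sum_product]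
      refine sum_congr rfl fun _ _ => sum_congr rfl fun _ _ => sum_congr rfl fun _ _ =>
        sum_congr rfl fun _ _ => sum_congr rfl fun _ _ => sum_congr rfl fun _ _ => by ring
    rw [h1, h2, h3]
    exact sq_sum₂_mul_le (Y ×ˢ Y) (Z ×ˢ Z) _ _
  have e₄ : C ^ 2 ≤ #Z ^ 2 * fourCycleSum X Z fun x z => v x z ^ 2 :=
    sq_cherrySum_le X Z fun x z => v x z ^ 2
  have hU0 : 0 ≤ U := by positivity
  have hS₁0 : 0 ≤ S₁ := by positivity
  have hFO : 0 ≤ F * octahedronSum X Y Z h := (sq_nonneg _).trans e₃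
  calc S ^ 8 = (S ^ 2) ^ 4 := by ring
    _ ≤ (U * S₁) ^ 4 := pow_le_pow_left₀ (sq_nonneg _) e₁ 4
    _ = U ^ 4 * (S₁ ^ 2) ^ 2 := by ring
    _ ≤ U ^ 4 * (C * S₂) ^ 2 := by gcongr
    _ = U ^ 4 * (C ^ 2 * S₂ ^ 2) := by ring
    _ ≤ U ^ 4 * ((#Z ^ 2 * fourCycleSum X Z fun x z => v x z ^ 2) *
          (F * octahedronSum X Y Z h)) := by
      gcongr ?_ * ?_
      exact mul_le_mul e₄ e₃ (sq_nonneg _) ((sq_nonneg _).trans e₄)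
    _ = _ := by ring

/-! ### Regular triads -/

namespace Bigraph

variable [DecidableEq α] [DecidableEq β]

theorem density_nonneg (G : Bigraph α β) : 0 ≤ G.density := by
  unfold density densityOn; positivity

theorem density_le_one (G : Bigraph α β) : G.density ≤ 1 := by
  refine div_le_one_of_le₀ ?_ (by positivity)
  rw [← Nat.cast_mul, ← Finset.card_product]
  exact_mod_cast card_le_card inter_subset_right

theorem card_edges_eq (G : Bigraph α β) :
    (#G.edges : ℝ) = G.density * (#G.left * #G.right) := by
  have h : G.edges ∩ G.left ×ˢ G.right = G.edges := inter_eq_left.2 G.edges_subset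
  unfold density densityOn
  rw [h]
  by_cases h0 : (#G.left * #G.right : ℝ) = 0
  · have : #G.edges ≤ #G.left * #G.right := by
      rw [← Finset.card_product]; exact card_le_card G.edges_subset
    have h' : #G.left * #G.right = 0 := by exact_mod_cast h0
    have : #G.edges = 0 := by omega
    simp [this]
  · exact (div_mul_cancel₀ _ h0).symm

/-- A bigraph of small deviation has at most a constant times the expected number of
four-cycles. -/
theorem HasDev2With.fourCycleSum_indicator_le {G : Bigraph α β} {ε d : ℝ}
    (h : G.HasDev2With ε d) (hε : ε ≤ G.density ^ 4) :
    fourCycleSum G.left G.right (fun x y => if (x, y) ∈ G.edges then (1 : ℝ) else 0) ≤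
      16 * G.density ^ 4 * #G.left ^ 2 * #G.right ^ 2 := by
  have h1 : (fun x y => if (x, y) ∈ G.edges then (1 : ℝ) else 0) =
      fun x y => (fun _ _ => G.density) x y + G.balanced x y := by
    funext x y
    unfold balanced
    split_ifs <;> ring
  have h2 : fourCycleSum G.left G.right (fun _ _ => G.density) =
      G.density ^ 4 * #G.left ^ 2 * #G.right ^ 2 := by
    simp only [fourCycleSum, sum_const, nsmul_eq_mul]
    ring
  have h3 : fourCycleSum G.left G.right G.balanced ≤
      G.density ^ 4 * #G.left ^ 2 * #G.right ^ 2 := by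
    refine h.2.trans ?_
    gcongr
  rw [h1]
  refine (fourCycleSum_add_le _ _ _ _).trans ?_
  rw [h2]
  linarith

theorem HasDev2With.le_two_mul_density {G : Bigraph α β} {ε d : ℝ}
    (h : G.HasDev2With ε d) (hε : ε ≤ G.density ^ 4) : d ≤ 2 * G.density := by
  have h1 := (abs_le.1 h.1).1
  have h2 : G.density ^ 4 ≤ G.density :=
    pow_le_of_le_one G.density_nonneg G.density_le_one (by norm_num)
  linarith

end Bigraph

namespace Triad

variable [DecidableEq α] [DecidableEq β] [DecidableEq γ]

/-- The number of triangles which a triad with the given edge densities is expected to have. -/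
noncomputable def expectedTriangles (G : Triad α β γ) : ℝ :=
  (G.bigraphXY.density * G.bigraphXZ.density * G.bigraphYZ.density) * (#G.X * #G.Y * #G.Z)

/-- All three component bigraphs of the triad have density at least `σ`. -/
def IsDense (G : Triad α β γ) (σ : ℝ) : Prop :=
  σ ≤ G.bigraphXY.density ∧ σ ≤ G.bigraphXZ.density ∧ σ ≤ G.bigraphYZ.density

theorem expectedTriangles_nonneg (G : Triad α β γ) : 0 ≤ G.expectedTriangles := by
  have := G.bigraphXY.density_nonneg
  have := G.bigraphXZ.density_nonneg
  have := G.bigraphYZ.density_nonneg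
  unfold expectedTriangles; positivity

end Triad

namespace Trigraph

variable [DecidableEq α] [DecidableEq β] [DecidableEq γ]

/-- The arithmetic behind `HasDev23.abs_sum_balanced_le`: the eight copies of each density and of
each vertex class size in `sum_pow_eight_le` are accounted for exactly. -/
theorem abs_le_of_pow_eight_le {S U V W O p q r x y z ε η : ℝ} (hε : 0 ≤ ε) (hη : 0 ≤ η)
    (hη' : 2 ^ 20 * ε ≤ η ^ 8) (hE : 0 ≤ p * q * r * (x * y * z))
    (h : S ^ 8 ≤ U ^ 4 * (z ^ 2 * V) * W * O) (hU : 0 ≤ U) (hU' : U ≤ p * (x * y))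
    (hV : 0 ≤ V) (hV' : V ≤ 16 * q ^ 4 * x ^ 2 * z ^ 2)
    (hW : 0 ≤ W) (hW' : W ≤ 16 * r ^ 4 * y ^ 2 * z ^ 2)
    (hO : O ≤ ε * (2 * p) ^ 4 * (2 * r) ^ 4 * (2 * q) ^ 4 * x ^ 2 * y ^ 2 * z ^ 2) :
    |S| ≤ η * (p * q * r * (x * y * z)) := by
  refine le_of_pow_le_pow_left₀ (n := 8) (by norm_num) (by positivity) ?_
  rw [Even.pow_abs (by decide)]
  calc S ^ 8 ≤ U ^ 4 * (z ^ 2 * V) * W * O := h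
    _ ≤ U ^ 4 * (z ^ 2 * V) * W *
        (ε * (2 * p) ^ 4 * (2 * r) ^ 4 * (2 * q) ^ 4 * x ^ 2 * y ^ 2 * z ^ 2) := by gcongr
    _ ≤ (p * (x * y)) ^ 4 * (z ^ 2 * (16 * q ^ 4 * x ^ 2 * z ^ 2)) *
        (16 * r ^ 4 * y ^ 2 * z ^ 2) *
        (ε * (2 * p) ^ 4 * (2 * r) ^ 4 * (2 * q) ^ 4 * x ^ 2 * y ^ 2 * z ^ 2) := by
        gcongr
    _ = (2 ^ 20 * ε) * (p * q * r * (x * y * z)) ^ 8 := by ring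
    _ ≤ η ^ 8 * (p * q * r * (x * y * z)) ^ 8 := by gcongr
    _ = _ := by ring

/-- On a regular triad, the balanced function of the trigraph correlates with no subtriad. The
four-cycle counts of the component bigraphs make the bound relative to the number of triangles. -/
theorem HasDev23.abs_sum_balanced_le {H : Trigraph α β γ} {G : Triad α β γ} {ε₁ ε₂ η σ : ℝ}
    (h : H.HasDev23 G ε₁ ε₂) (hε₁ : 0 ≤ ε₁) (hη : 0 ≤ η) (hη' : 2 ^ 20 * ε₁ ≤ η ^ 8)
    (hσ : 0 ≤ σ) (hG : G.IsDense σ) (hε₂ : ε₂ ≤ σ ^ 4)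
    {Q : Finset (α × β)} (hQ : Q ⊆ G.EXY) {R : Finset (α × γ)} (hR : R ⊆ G.EXZ) :
    |∑ x ∈ G.X, ∑ y ∈ G.Y, ∑ z ∈ G.Z, H.balanced G x y z *
      ((if (x, y) ∈ Q then 1 else 0) * (if (x, z) ∈ R then 1 else 0) *
        (if (y, z) ∈ G.EYZ then 1 else 0))| ≤ η * G.expectedTriangles := by
  obtain ⟨a, c, b, ha, hc, hb, hXY, hXZ, hYZ, hO⟩ := h
  have gXY : ε₂ ≤ G.bigraphXY.density ^ 4 := hε₂.trans (pow_le_pow_left₀ hσ hG.1 4)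
  have gXZ : ε₂ ≤ G.bigraphXZ.density ^ 4 := hε₂.trans (pow_le_pow_left₀ hσ hG.2.1 4)
  have gYZ : ε₂ ≤ G.bigraphYZ.density ^ 4 := hε₂.trans (pow_le_pow_left₀ hσ hG.2.2 4)
  have la := hXY.le_two_mul_density gXY
  have lb := hXZ.le_two_mul_density gXZ
  have lc := hYZ.le_two_mul_density gYZ
  have cXZ := hXZ.fourCycleSum_indicator_le gXZ
  have cYZ := hYZ.fourCycleSum_indicator_le gYZ
  have eXY := G.bigraphXY.card_edges_eq
  have hE0 := G.expectedTriangles_nonneg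
  have nXY := G.bigraphXY.density_nonneg
  have nXZ := G.bigraphXZ.density_nonneg
  have nYZ := G.bigraphYZ.density_nonneg
  unfold Triad.expectedTriangles at hE0 ⊢
  set p := G.bigraphXY.density
  set q := G.bigraphXZ.density
  set r := G.bigraphYZ.density
  change fourCycleSum G.X G.Z (fun x y => if (x, y) ∈ G.EXZ then (1 : ℝ) else 0) ≤
      16 * q ^ 4 * #G.X ^ 2 * #G.Z ^ 2 at cXZ
  change fourCycleSum G.Y G.Z (fun x y => if (x, y) ∈ G.EYZ then (1 : ℝ) else 0) ≤
      16 * r ^ 4 * #G.Y ^ 2 * #G.Z ^ 2 at cYZ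
  change (#G.EXY : ℝ) = p * (#G.X * #G.Y) at eXY
  have bU : ∑ x ∈ G.X, ∑ y ∈ G.Y, (if (x, y) ∈ Q then (1 : ℝ) else 0) ^ 2 ≤
      p * (#G.X * #G.Y) := by
    rw [← eXY, ← Finset.sum_product' G.X G.Y fun x y => (if (x, y) ∈ Q then (1 : ℝ) else 0) ^ 2]
    simp only [Prod.mk.eta, ite_pow, one_pow, ne_eq, OfNat.ofNat_ne_zero, not_false_eq_true,
      zero_pow, sum_boole]
    exact_mod_cast card_le_card fun e he => hQ (mem_filter.1 he).2
  have bV : fourCycleSum G.X G.Z (fun x z => (if (x, z) ∈ R then (1 : ℝ) else 0) ^ 2) ≤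
      16 * q ^ 4 * #G.X ^ 2 * #G.Z ^ 2 := by
    refine (fourCycleSum_mono _ _ (fun _ _ => by positivity) fun x _ z _ => ?_).trans cXZ
    by_cases hxz : (x, z) ∈ R
    · simp [hxz, hR hxz]
    · rw [if_neg hxz]; split_ifs <;> norm_num
  have bW : fourCycleSum G.Y G.Z (fun y z => (if (y, z) ∈ G.EYZ then (1 : ℝ) else 0) ^ 2) ≤
      16 * r ^ 4 * #G.Y ^ 2 * #G.Z ^ 2 := by
    refine (fourCycleSum_mono _ _ (fun _ _ => by positivity) fun x _ z _ => ?_).trans cYZ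
    split_ifs <;> norm_num
  have bO : octahedronSum G.X G.Y G.Z (H.balanced G) ≤
      ε₁ * (2 * p) ^ 4 * (2 * r) ^ 4 * (2 * q) ^ 4 * #G.X ^ 2 * #G.Y ^ 2 * #G.Z ^ 2 := by
    refine hO.trans ?_
    gcongr
  have key := sum_pow_eight_le G.X G.Y G.Z (H.balanced G)
    (fun x y => if (x, y) ∈ Q then 1 else 0) (fun x z => if (x, z) ∈ R then 1 else 0)
    (fun y z => if (y, z) ∈ G.EYZ then 1 else 0)
  have fV := fourCycleSum_nonneg G.X G.Z (fun x z => (if (x, z) ∈ R then (1 : ℝ) else 0) ^ 2)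
  have fW := fourCycleSum_nonneg G.Y G.Z (fun x z => (if (x, z) ∈ G.EYZ then (1 : ℝ) else 0) ^ 2)
  exact abs_le_of_pow_eight_le hε₁ hη hη' hE0 key (by positivity) bU fV bV fW bW bO

/-- If the balanced function has absolute value at least `1/2` and constant sign on a set of
triangles cut out by subsets of two of the component bigraphs, then this set is small. -/
theorem HasDev23.card_filter_le {H : Trigraph α β γ} {G : Triad α β γ} {ε₁ ε₂ η σ : ℝ}
    (h : H.HasDev23 G ε₁ ε₂) (hε₁ : 0 ≤ ε₁) (hη : 0 ≤ η) (hη' : 2 ^ 20 * ε₁ ≤ η ^ 8)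
    (hσ : 0 ≤ σ) (hG : G.IsDense σ) (hε₂ : ε₂ ≤ σ ^ 4)
    {Q : Finset (α × β)} (hQ : Q ⊆ G.EXY) {R : Finset (α × γ)} (hR : R ⊆ G.EXZ)
    (hpred : ∀ p ∈ G.triangles, (p.1, p.2.1) ∈ Q → (p.1, p.2.2) ∈ R →
      (p ∈ H.edges ↔ ¬ 1 / 2 ≤ H.relDensity G)) :
    (#{p ∈ G.triangles | (p.1, p.2.1) ∈ Q ∧ (p.1, p.2.2) ∈ R} : ℝ) ≤
      2 * η * G.expectedTriangles := by
  have key := h.abs_sum_balanced_le hε₁ hη hη' hσ hG hε₂ hQ hR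
  set T := {p ∈ G.triangles | (p.1, p.2.1) ∈ Q ∧ (p.1, p.2.2) ∈ R} with hT
  set δ : ℝ := if 1 / 2 ≤ H.relDensity G then - H.relDensity G else 1 - H.relDensity G with hδ
  have hsum : ∑ x ∈ G.X, ∑ y ∈ G.Y, ∑ z ∈ G.Z, H.balanced G x y z *
      ((if (x, y) ∈ Q then 1 else 0) * (if (x, z) ∈ R then 1 else 0) *
        (if (y, z) ∈ G.EYZ then 1 else 0)) = #T * δ := by
    have h1 : (#T * δ : ℝ) = ∑ p ∈ G.X ×ˢ G.Y ×ˢ G.Z, if p ∈ T then δ else 0 := by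
      rw [← Finset.sum_filter, sum_const, nsmul_eq_mul]
      congr 3
      ext p
      simp only [hT, Triad.triangles, mem_filter]
      tauto
    rw [h1, Finset.sum_product]
    refine sum_congr rfl fun x hx => ?_
    rw [Finset.sum_product]
    refine sum_congr rfl fun y hy => sum_congr rfl fun z hz => ?_
    by_cases hp : (x, y, z) ∈ T
    · have hp' := hp
      rw [hT, mem_filter] at hp'
      obtain ⟨ht, hq, hr⟩ := hp'
      have hyz : (y, z) ∈ G.EYZ := (mem_filter.1 ht).2.2.1
      have := hpred _ ht hq hr
      simp only [hp, hyz, hq, hr, if_true, mul_one, balanced, ht, this, hδ]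
      split_ifs <;> simp_all
    · rw [if_neg hp]
      have : (x, y, z) ∉ G.triangles ∨ (x, y) ∉ Q ∨ (x, z) ∉ R := by
        rw [hT, mem_filter] at hp; tauto
      rcases this with h | h | h
      · simp [balanced, h]
      · simp [h]
      · simp [h]
  rw [hsum, abs_mul, Nat.abs_cast] at key
  have hδ' : 1 / 2 ≤ |δ| := by
    rw [hδ]
    split_ifs with h
    · rw [abs_neg]; exact h.trans (le_abs_self _)
    · exact le_trans (by linarith) (le_abs_self _)
  nlinarith [mul_le_mul_of_nonneg_left hδ' (Nat.cast_nonneg (α := ℝ) (#T))]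

end Trigraph

end

/-! ### Predictions from a regular decomposition -/

namespace Decomposition

variable {V : Type*} [DecidableEq V] {t ℓ : ℕ} (P : Decomposition V t ℓ)

/-- The index of the class of the decomposition which contains a vertex. -/
noncomputable def classIndex (x : V) : Fin t := (P.cls_cover x).choose

theorem mem_cls_classIndex (x : V) : x ∈ P.cls (P.classIndex x) := (P.cls_cover x).choose_spec

theorem mem_cls_iff {x : V} {i : Fin t} : x ∈ P.cls i ↔ i = P.classIndex x := by
  refine ⟨fun h => ?_, fun h => h ▸ P.mem_cls_classIndex x⟩
  by_contra hne
  exact disjoint_left.1 (P.cls_disjoint _ _ hne) h (P.mem_cls_classIndex x)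

theorem exists_mem_piece (x y : V) : ∃ a, (x, y) ∈ P.piece (P.classIndex x) (P.classIndex y) a := by
  have : (x, y) ∈ P.cls (P.classIndex x) ×ˢ P.cls (P.classIndex y) :=
    mk_mem_product (P.mem_cls_classIndex x) (P.mem_cls_classIndex y)
  rw [← P.piece_cover] at this
  simpa using this

/-- The index of the piece of the decomposition which contains a pair. -/
noncomputable def pieceIndex (x y : V) : Fin ℓ := (P.exists_mem_piece x y).choose

theorem mem_piece_pieceIndex (x y : V) :
    (x, y) ∈ P.piece (P.classIndex x) (P.classIndex y) (P.pieceIndex x y) :=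
  (P.exists_mem_piece x y).choose_spec

theorem mem_piece_iff {x y : V} {i j : Fin t} {a : Fin ℓ} :
    (x, y) ∈ P.piece i j a ↔
      i = P.classIndex x ∧ j = P.classIndex y ∧ a = P.pieceIndex x y := by
  refine ⟨fun h => ?_, ?_⟩
  · have h' := mem_product.1 (P.piece_subset _ _ _ h)
    obtain rfl := P.mem_cls_iff.1 h'.1
    obtain rfl := P.mem_cls_iff.1 h'.2
    refine ⟨rfl, rfl, ?_⟩
    by_contra hne
    exact disjoint_left.1 (P.piece_disjoint _ _ _ _ hne) h (P.mem_piece_pieceIndex x y)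
  · rintro ⟨rfl, rfl, rfl⟩
    exact P.mem_piece_pieceIndex x y

/-- The triad of the decomposition one of whose triangles is `(x, y, z)`. -/
noncomputable def tripleTriad (x y z : V) : Triad V V V :=
  P.triad (P.classIndex x) (P.classIndex y) (P.classIndex z)
    (P.pieceIndex x y) (P.pieceIndex x z) (P.pieceIndex y z)

theorem mem_triangles_triad_iff {x y z : V} {i j k : Fin t} {a b c : Fin ℓ} :
    (x, y, z) ∈ (P.triad i j k a b c).triangles ↔
      i = P.classIndex x ∧ j = P.classIndex y ∧ k = P.classIndex z ∧
        a = P.pieceIndex x y ∧ b = P.pieceIndex x z ∧ c = P.pieceIndex y z := by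
  simp only [Triad.triangles, triad, mem_filter, mem_product, mem_cls_iff, mem_piece_iff]
  tauto

theorem eq_tripleTriad_of_mem_triangles {x y z : V} {i j k : Fin t} {a b c : Fin ℓ}
    (h : (x, y, z) ∈ (P.triad i j k a b c).triangles) :
    P.triad i j k a b c = P.tripleTriad x y z := by
  obtain ⟨rfl, rfl, rfl, rfl, rfl, rfl⟩ := P.mem_triangles_triad_iff.1 h
  rfl

theorem sum_density_le_one (i j : Fin t) : ∑ a, (P.bigraph i j a).density ≤ 1 := by
  have h : ∀ a, (P.bigraph i j a).density = #(P.piece i j a) / (#(P.cls i) * #(P.cls j) : ℝ) := by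
    intro a
    have : P.piece i j a ∩ P.cls i ×ˢ P.cls j = P.piece i j a :=
      inter_eq_left.2 (P.piece_subset i j a)
    simp only [Bigraph.density, Bigraph.densityOn, bigraph, this]
  simp only [h]
  rw [← Finset.sum_div, ← Nat.cast_sum, ← card_biUnion, P.piece_cover, card_product, Nat.cast_mul]
  · exact div_self_le_one _
  · exact fun a _ b _ hab => P.piece_disjoint i j a b hab

variable [Fintype V]

theorem sum_card_cls : ∑ i, (#(P.cls i) : ℝ) = Fintype.card V := by
  rw [← Nat.cast_sum, ← card_biUnion, ← Finset.card_univ]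
  · congr 2
    ext x
    simpa using ⟨_, P.mem_cls_classIndex x⟩
  · exact fun i _ j _ hij => P.cls_disjoint i j hij

theorem sum_expectedTriangles_le :
    ∑ i, ∑ j, ∑ k, ∑ a, ∑ b, ∑ c, (P.triad i j k a b c).expectedTriangles ≤
      (Fintype.card V : ℝ) ^ 3 := by
  have h : ∀ i j k, ∑ a, ∑ b, ∑ c, (P.triad i j k a b c).expectedTriangles ≤
      #(P.cls i) * (#(P.cls j) * #(P.cls k)) := by
    intro i j k
    have h1 : ∑ a, ∑ b, ∑ c, (P.triad i j k a b c).expectedTriangles =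
        ((∑ a, (P.bigraph i j a).density) * (∑ b, (P.bigraph i k b).density) *
          ∑ c, (P.bigraph j k c).density) * (#(P.cls i) * (#(P.cls j) * #(P.cls k))) := by
      rw [Finset.sum_mul_sum, Finset.sum_mul, Finset.sum_mul]
      refine sum_congr rfl fun a _ => ?_
      rw [Finset.sum_mul, Finset.sum_mul]
      refine sum_congr rfl fun b _ => ?_
      rw [Finset.mul_sum, Finset.sum_mul]
      refine sum_congr rfl fun c _ => ?_
      simp only [Triad.expectedTriangles, Triad.bigraphXY, Triad.bigraphXZ, Triad.bigraphYZ,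
        triad, bigraph]
      ring
    rw [h1]
    refine mul_le_of_le_one_left (by positivity) ?_
    have n1 : 0 ≤ ∑ a, (P.bigraph i j a).density := sum_nonneg fun _ _ => Bigraph.density_nonneg _
    have n2 : 0 ≤ ∑ a, (P.bigraph i k a).density := sum_nonneg fun _ _ => Bigraph.density_nonneg _
    have n3 : 0 ≤ ∑ a, (P.bigraph j k a).density := sum_nonneg fun _ _ => Bigraph.density_nonneg _
    exact mul_le_one₀ (mul_le_one₀ (P.sum_density_le_one i j) n2 (P.sum_density_le_one i k)) n3
      (P.sum_density_le_one j k)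
  refine (sum_le_sum fun i _ => sum_le_sum fun j _ => sum_le_sum fun k _ => h i j k).trans_eq ?_
  simp only [← Finset.mul_sum, ← Finset.sum_mul, P.sum_card_cls]
  ring

open scoped Classical in
/-- Few pairs lie in pieces of small density. -/
theorem card_sparse_pairs_le {σ : ℝ} (hσ : 0 ≤ σ) :
    (#{p : V × V | (P.bigraph (P.classIndex p.1) (P.classIndex p.2)
        (P.pieceIndex p.1 p.2)).density < σ} : ℝ) ≤ ℓ * σ * (Fintype.card V : ℝ) ^ 2 := by
  have hsub : ({p : V × V | (P.bigraph (P.classIndex p.1) (P.classIndex p.2)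
      (P.pieceIndex p.1 p.2)).density < σ} : Finset _) ⊆ (univ : Finset (Fin t × Fin t × Fin ℓ)).biUnion
        fun q => if (P.bigraph q.1 q.2.1 q.2.2).density < σ then P.piece q.1 q.2.1 q.2.2
          else (∅ : Finset (V × V)) := by
    rintro ⟨x, y⟩ hp
    simp only [Finset.mem_filter, Finset.mem_univ, true_and] at hp
    rw [mem_biUnion]
    refine ⟨(P.classIndex x, P.classIndex y, P.pieceIndex x y), mem_univ _, ?_⟩
    rw [if_pos hp]
    exact P.mem_piece_pieceIndex x y
  have h1 : (#{p : V × V | (P.bigraph (P.classIndex p.1) (P.classIndex p.2)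
      (P.pieceIndex p.1 p.2)).density < σ} : ℝ) ≤
      ∑ q : Fin t × Fin t × Fin ℓ, σ * (#(P.cls q.1) * #(P.cls q.2.1)) := by
    refine (Nat.cast_le.2 ((card_le_card hsub).trans card_biUnion_le)).trans ?_
    rw [Nat.cast_sum]
    refine sum_le_sum fun q _ => ?_
    split_ifs with hq
    · refine ((P.bigraph q.1 q.2.1 q.2.2).card_edges_eq).trans_le ?_
      exact mul_le_mul_of_nonneg_right hq.le (by positivity)
    · simp only [card_empty, Nat.cast_zero]; positivity
  refine h1.trans_eq ?_
  simp only [Fintype.sum_prod_type, sum_const, card_univ, Fintype.card_fin, nsmul_eq_mul,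
    ← Finset.mul_sum, ← Finset.sum_mul, P.sum_card_cls]
  ring

open scoped Classical in
/-- Few triples lie in triads with a component bigraph of small density. -/
theorem card_not_isDense_le {σ : ℝ} (hσ : 0 ≤ σ) :
    (#{p : V × V × V | ¬ (P.tripleTriad p.1 p.2.1 p.2.2).IsDense σ} : ℝ) ≤
      3 * (ℓ * σ * (Fintype.card V : ℝ) ^ 3) := by
  set L : Finset (V × V) := {p : V × V | (P.bigraph (P.classIndex p.1) (P.classIndex p.2)
        (P.pieceIndex p.1 p.2)).density < σ} with hL
  have hLc := P.card_sparse_pairs_le hσ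
  rw [← hL] at hLc
  have hsub : ({p : V × V × V | ¬ (P.tripleTriad p.1 p.2.1 p.2.2).IsDense σ} : Finset _) ⊆
      (L ×ˢ univ).image (fun q : (V × V) × V => (q.1.1, q.1.2, q.2)) ∪
      (L ×ˢ univ).image (fun q : (V × V) × V => (q.1.1, q.2, q.1.2)) ∪
      (L ×ˢ univ).image (fun q : (V × V) × V => (q.2, q.1.1, q.1.2)) := by
    rintro ⟨x, y, z⟩ hp
    simp only [mem_filter, mem_univ, true_and, Triad.IsDense, not_and_or, not_le] at hp
    simp only [mem_union, mem_image, mem_product, mem_univ, and_true]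
    rcases hp with h | h | h
    · exact Or.inl (Or.inl ⟨((x, y), z), by rw [hL]; exact mem_filter.2 ⟨mem_univ _, h⟩, rfl⟩)
    · exact Or.inl (Or.inr ⟨((x, z), y), by rw [hL]; exact mem_filter.2 ⟨mem_univ _, h⟩, rfl⟩)
    · exact Or.inr ⟨((y, z), x), by rw [hL]; exact mem_filter.2 ⟨mem_univ _, h⟩, rfl⟩
  have hc : ∀ f : (V × V) × V → V × V × V, #((L ×ˢ univ).image f) ≤ #L * Fintype.card V :=
    fun f => card_image_le.trans_eq (by rw [card_product, card_univ])
  have h2 := (card_le_card hsub).trans ((card_union_le _ _).trans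
    (add_le_add ((card_union_le _ _).trans (add_le_add (hc _) (hc _))) (hc _)))
  refine (Nat.cast_le.2 h2).trans ?_
  push_cast
  nlinarith [mul_le_mul_of_nonneg_right hLc (Nat.cast_nonneg (α := ℝ) (Fintype.card V))]

variable (H : ThreeGraph V)

/-- The density of `H` on the triad of the decomposition which contains `(x, y, z)` predicts the
wrong answer to the question whether `(x, y, z)` is an edge. -/
def IsMispredicted (x y z : V) : Prop :=
  (x, y, z) ∈ H.toTrigraph.edges ↔
    ¬ 1 / 2 ≤ (H.toTrigraph.restrict (P.tripleTriad x y z)).relDensity (P.tripleTriad x y z)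

/-- The triad of the decomposition which contains `(x, y, z)` is regular, and its component
bigraphs have density at least `σ`. -/
def IsGoodTriple (ε₁ ε₂ σ : ℝ) (x y z : V) : Prop :=
  (H.toTrigraph.restrict (P.tripleTriad x y z)).HasDev23 (P.tripleTriad x y z) ε₁ ε₂ ∧
    (P.tripleTriad x y z).IsDense σ

/-- Either the triad which contains `(x, y, z)` is not good, or its prediction is wrong. -/
def IsBadTriple (ε₁ ε₂ σ : ℝ) (x y z : V) : Prop :=
  ¬ P.IsGoodTriple H ε₁ ε₂ σ x y z ∨ P.IsMispredicted H x y z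

open scoped Classical in
theorem card_not_isGoodTriple_le {ε₁ ε₂ σ : ℝ} (hσ : 0 ≤ σ) (hP : P.IsRegular H ε₁ ε₂) :
    (#{p : V × V × V | ¬ P.IsGoodTriple H ε₁ ε₂ σ p.1 p.2.1 p.2.2} : ℝ) ≤
      (ε₁ + 3 * (ℓ * σ)) * (Fintype.card V : ℝ) ^ 3 := by
  have hsub : ({p : V × V × V | ¬ P.IsGoodTriple H ε₁ ε₂ σ p.1 p.2.1 p.2.2} : Finset _) ⊆
      (univ.filter fun p : V × V × V =>
        ¬ ∃ i j k a b c, p ∈ (P.triad i j k a b c).triangles ∧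
          (H.toTrigraph.restrict (P.triad i j k a b c)).HasDev23 (P.triad i j k a b c) ε₁ ε₂) ∪
      ({p : V × V × V | ¬ (P.tripleTriad p.1 p.2.1 p.2.2).IsDense σ} : Finset _) := by
    rintro ⟨x, y, z⟩ hp
    simp only [mem_union, mem_filter, mem_univ, true_and] at hp ⊢
    by_contra! hcon
    obtain ⟨⟨i, j, k, a, b, c, ht, hdev⟩, hd⟩ := hcon
    rw [P.eq_tripleTriad_of_mem_triangles ht] at hdev
    exact hp ⟨hdev, hd⟩
  refine (Nat.cast_le.2 ((card_le_card hsub).trans (card_union_le _ _))).trans ?_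
  rw [Nat.cast_add]
  unfold IsRegular at hP
  have := P.card_not_isDense_le hσ
  linarith

open scoped Classical in
/-- If the link of every vertex of `C` agrees with the same bigraph on `A × B`, then few triples
of `A × B × C` in good triads are mispredicted. -/
theorem card_mispredicted_le {ε₁ ε₂ η σ : ℝ} (hε₁ : 0 ≤ ε₁) (hη : 0 ≤ η)
    (hη' : 2 ^ 20 * ε₁ ≤ η ^ 8) (hσ : 0 ≤ σ) (hε₂ : ε₂ ≤ σ ^ 4) (A B C : Finset V)
    (N : V → V → Prop)
    (hN : ∀ x ∈ A, ∀ y ∈ B, ∀ z ∈ C, (x, y, z) ∈ H.toTrigraph.edges ↔ N x y) :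
    (#{p : V × V × V | p.1 ∈ A ∧ p.2.1 ∈ B ∧ p.2.2 ∈ C ∧
        P.IsGoodTriple H ε₁ ε₂ σ p.1 p.2.1 p.2.2 ∧ P.IsMispredicted H p.1 p.2.1 p.2.2} : ℝ) ≤
      2 * η * (Fintype.card V : ℝ) ^ 3 := by
  set W : Finset (V × V × V) := {p : V × V × V | p.1 ∈ A ∧ p.2.1 ∈ B ∧ p.2.2 ∈ C ∧
        P.IsGoodTriple H ε₁ ε₂ σ p.1 p.2.1 p.2.2 ∧ P.IsMispredicted H p.1 p.2.1 p.2.2} with hW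
  have hloc : ∀ i j k a b c, (#{p ∈ W | p ∈ (P.triad i j k a b c).triangles} : ℝ) ≤
      2 * η * (P.triad i j k a b c).expectedTriangles := by
    intro i j k a b c
    set G := P.triad i j k a b c with hG
    by_cases hgood : (H.toTrigraph.restrict G).HasDev23 G ε₁ ε₂ ∧ G.IsDense σ
    · set Q : Finset (V × V) := {e ∈ G.EXY | e.1 ∈ A ∧ e.2 ∈ B ∧
        (N e.1 e.2 ↔ ¬ 1 / 2 ≤ (H.toTrigraph.restrict G).relDensity G)} with hQ
      set R : Finset (V × V) := {e ∈ G.EXZ | e.2 ∈ C} with hR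
      refine le_trans (Nat.cast_le.2 (card_le_card ?_)) (hgood.1.card_filter_le (Q := Q) (R := R)
        hε₁ hη hη' hσ hgood.2 hε₂ (filter_subset _ _) (filter_subset _ _) ?_)
      · rintro ⟨x, y, z⟩ hp
        simp only [hW, mem_filter, mem_univ, true_and] at hp
        obtain ⟨⟨hx, hy, hz, -, hmis⟩, ht⟩ := hp
        have ht' := mem_filter.1 ht
        rw [IsMispredicted, ← P.eq_tripleTriad_of_mem_triangles ht, hN x hx y hy z hz] at hmis
        simp only [mem_filter, hQ, hR]
        exact ⟨ht, ⟨ht'.2.1, hx, hy, hmis⟩, ht'.2.2.2, hz⟩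
      · rintro ⟨x, y, z⟩ ht hq hr
        simp only [mem_filter, hQ, hR] at hq hr
        rw [← hq.2.2.2, ← hN x hq.2.1 y hq.2.2.1 z hr.2]
        simp [Trigraph.restrict, ht]
    · have : {p ∈ W | p ∈ G.triangles} = ∅ := by
        refine filter_eq_empty_iff.2 ?_
        rintro ⟨x, y, z⟩ hp ht
        simp only [hW, mem_filter, mem_univ, true_and] at hp
        have h := hp.2.2.2.1
        rw [IsGoodTriple, ← P.eq_tripleTriad_of_mem_triangles ht] at h
        exact hgood h
      rw [this]
      have := G.expectedTriangles_nonneg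
      simp only [card_empty, Nat.cast_zero]
      positivity
  have hsub : W ⊆ (univ : Finset (Fin t × Fin t × Fin t × Fin ℓ × Fin ℓ × Fin ℓ)).biUnion
      fun q => {p ∈ W | p ∈ (P.triad q.1 q.2.1 q.2.2.1 q.2.2.2.1 q.2.2.2.2.1
        q.2.2.2.2.2).triangles} := by
    rintro ⟨x, y, z⟩ hp
    rw [mem_biUnion]
    refine ⟨(P.classIndex x, P.classIndex y, P.classIndex z, P.pieceIndex x y, P.pieceIndex x z,
      P.pieceIndex y z), mem_univ _, mem_filter.2 ⟨hp, P.mem_triangles_triad_iff.2 (by simp)⟩⟩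
  refine (Nat.cast_le.2 ((card_le_card hsub).trans card_biUnion_le)).trans ?_
  rw [Nat.cast_sum]
  refine (sum_le_sum fun q _ => hloc _ _ _ _ _ _).trans ?_
  rw [← Finset.mul_sum]
  simp only [Fintype.sum_prod_type]
  exact mul_le_mul_of_nonneg_left P.sum_expectedTriangles_le (by positivity)

open scoped Classical in
/-- In a blowup-like structure on `A × B × ⋃ C w`, all but few triples lie in good triads and are
correctly predicted. -/
theorem card_bad_le {κ : Type*} [Fintype κ] {ε₁ ε₂ η σ : ℝ} (hε₁ : 0 ≤ ε₁) (hη : 0 ≤ η)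
    (hη' : 2 ^ 20 * ε₁ ≤ η ^ 8) (hσ : 0 ≤ σ) (hε₂ : ε₂ ≤ σ ^ 4) (hP : P.IsRegular H ε₁ ε₂)
    (A B : Finset V) (C : κ → Finset V) (N : κ → V → V → Prop)
    (hN : ∀ w, ∀ x ∈ A, ∀ y ∈ B, ∀ z ∈ C w, (x, y, z) ∈ H.toTrigraph.edges ↔ N w x y) :
    (#{p ∈ A ×ˢ B ×ˢ univ.biUnion C | P.IsBadTriple H ε₁ ε₂ σ p.1 p.2.1 p.2.2} : ℝ) ≤
      (ε₁ + 3 * (ℓ * σ) + 2 * (Fintype.card κ * η)) * (Fintype.card V : ℝ) ^ 3 := by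
  have hsub : {p ∈ A ×ˢ B ×ˢ univ.biUnion C | P.IsBadTriple H ε₁ ε₂ σ p.1 p.2.1 p.2.2} ⊆
      ({p : V × V × V | ¬ P.IsGoodTriple H ε₁ ε₂ σ p.1 p.2.1 p.2.2} : Finset _) ∪
      univ.biUnion fun w => ({p : V × V × V | p.1 ∈ A ∧ p.2.1 ∈ B ∧ p.2.2 ∈ C w ∧
        P.IsGoodTriple H ε₁ ε₂ σ p.1 p.2.1 p.2.2 ∧
        P.IsMispredicted H p.1 p.2.1 p.2.2} : Finset _) := by
    rintro ⟨x, y, z⟩ hp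
    simp only [mem_filter, mem_product, mem_biUnion, mem_univ, true_and, mem_union] at hp ⊢
    obtain ⟨⟨hx, hy, w, hz⟩, h⟩ := hp
    by_cases hg : P.IsGoodTriple H ε₁ ε₂ σ x y z
    · exact Or.inr ⟨w, hx, hy, hz, hg, h.resolve_left (not_not.2 hg)⟩
    · exact Or.inl hg
  refine (Nat.cast_le.2 ((card_le_card hsub).trans ((card_union_le _ _).trans
    (add_le_add_right card_biUnion_le _)))).trans ?_
  rw [Nat.cast_add, Nat.cast_sum]
  have h1 := P.card_not_isGoodTriple_le H hσ hP
  have h2 := sum_le_sum fun w (_ : w ∈ univ) =>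
    P.card_mispredicted_le H hε₁ hη hη' hσ hε₂ A B (C w) (N w) (hN w)
  rw [sum_const, card_univ, nsmul_eq_mul] at h2
  linarith

end Decomposition

/-! ### Counting colors -/

/-- The error term `ε * (#G.left * #G.right)` covers the sets too small for regularity to say
anything about them. -/
theorem Bigraph.IsEpsRegular.card_inter_le {α β : Type*} [DecidableEq α] [DecidableEq β]
    {G : Bigraph α β} {ε d : ℝ} (h : G.IsEpsRegular ε) (hd : G.density ≤ d + ε) (hε : 0 ≤ ε)
    (hd0 : 0 ≤ d) {X : Finset α} {Y : Finset β} (hX : X ⊆ G.left) (hY : Y ⊆ G.right) :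
    (#(G.edges ∩ X ×ˢ Y) : ℝ) ≤ (d + 2 * ε) * (#X * #Y) + ε * (#G.left * #G.right) := by
  have htriv : (#(G.edges ∩ X ×ˢ Y) : ℝ) ≤ #X * #Y := by
    rw [← Nat.cast_mul, ← card_product]
    exact_mod_cast card_le_card inter_subset_right
  have hXc : (#X : ℝ) ≤ #G.left := by exact_mod_cast card_le_card hX
  have hYc : (#Y : ℝ) ≤ #G.right := by exact_mod_cast card_le_card hY
  have hmain : 0 ≤ (d + 2 * ε) * (#X * #Y : ℝ) := by positivity
  by_cases h1 : ε * #G.left ≤ (#X : ℝ)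
  · by_cases h2 : ε * #G.right ≤ (#Y : ℝ)
    · have h3 := (abs_le.1 (h X hX Y hY h1 h2)).1
      have h4 : G.densityOn X Y ≤ d + 2 * ε := by linarith
      have h5 : (#(G.edges ∩ X ×ˢ Y) : ℝ) ≤ G.densityOn X Y * (#X * #Y) := by
        unfold densityOn
        by_cases h0 : (#X * #Y : ℝ) = 0
        · rw [h0] at htriv ⊢; simpa using htriv
        · exact (div_mul_cancel₀ _ h0).ge
      have h6 : G.densityOn X Y * (#X * #Y : ℝ) ≤ (d + 2 * ε) * (#X * #Y) := by gcongr
      have : 0 ≤ ε * (#G.left * #G.right : ℝ) := by positivity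
      linarith
    · have : (#X * #Y : ℝ) ≤ #G.left * (ε * #G.right) :=
        mul_le_mul hXc (not_le.1 h2).le (by positivity) (by positivity)
      linarith
  · have : (#X * #Y : ℝ) ≤ (ε * #G.left) * #G.right :=
      mul_le_mul (not_le.1 h1).le hYc (by positivity) (by positivity)
    linarith

/-- The number of subsets of `[K]` of size at most `K / 10`. -/
def smallSubsets (K : ℕ) : ℕ := #{T : Finset (Fin K) | 10 * #T ≤ K}

/-- Weighting each set `T` by `(1 / 2) ^ #T` gives a total of `(3 / 2) ^ K`, and
`(3 / 2) ^ 10 * 2 ≤ 2 ^ 7`. -/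
theorem smallSubsets_pow_le (K : ℕ) : (smallSubsets K : ℝ) ^ 10 ≤ 2 ^ (7 * K) := by
  have h1 : (smallSubsets K : ℝ) * (1 / 2) ^ (K / 10) ≤ (3 / 2) ^ K := by
    have h2 : ∑ T : Finset (Fin K), (1 / 2 : ℝ) ^ #T * 1 ^ (K - #T) = (1 / 2 + 1) ^ K := by
      simpa using Fintype.sum_pow_mul_eq_add_pow (Fin K) (1 / 2 : ℝ) 1
    have h3 : (smallSubsets K : ℝ) * (1 / 2) ^ (K / 10) ≤
        ∑ T : Finset (Fin K), (1 / 2 : ℝ) ^ #T * 1 ^ (K - #T) := by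
      rw [smallSubsets, ← nsmul_eq_mul]
      refine (card_nsmul_le_sum _ (fun T => (1 / 2 : ℝ) ^ #T * 1 ^ (K - #T)) _ ?_).trans
        (sum_le_sum_of_subset_of_nonneg (subset_univ _) fun _ _ _ => by positivity)
      intro T hT
      rw [one_pow, mul_one]
      refine pow_le_pow_of_le_one (by norm_num) (by norm_num) ?_
      have := (mem_filter.1 hT).2
      omega
    refine h3.trans (h2.trans_le ?_)
    norm_num
  have h4 : (smallSubsets K : ℝ) ≤ (3 / 2) ^ K * 2 ^ (K / 10) := by
    rw [one_div, inv_pow, ← div_eq_mul_inv, div_le_iff₀ (by positivity)] at h1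
    exact h1
  calc (smallSubsets K : ℝ) ^ 10 ≤ ((3 / 2) ^ K * 2 ^ (K / 10)) ^ 10 := by gcongr
    _ = ((3 / 2) ^ 10) ^ K * 2 ^ (10 * (K / 10)) := by
        rw [mul_pow, ← pow_mul, ← pow_mul, ← pow_mul, mul_comm K, mul_comm (K / 10)]
    _ ≤ ((3 / 2) ^ 10) ^ K * 2 ^ K := by
        gcongr
        · norm_num
        · omega
    _ = ((3 / 2) ^ 10 * 2) ^ K := by rw [mul_pow]
    _ ≤ (2 ^ 7) ^ K := by gcongr; norm_num
    _ = 2 ^ (7 * K) := by rw [pow_mul]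

open scoped Classical in
/-- If the colors are regular bigraphs of density about `2 ^ (-K)`, then few pairs have a color
close to a guess which depends only on labels of the two vertices and one of `ℓ` labels of the
pair. Each guess is close to few colors, and each color is uniformly distributed over the cells
of the vertex labels. -/
theorem card_close_to_guess_le {V : Type*} [DecidableEq V] {K ℓ n : ℕ}
    {U : Finset (Finset (Fin K))} (Γ : ColoredBipartite V U) (hA : #Γ.A = n) (hB : #Γ.B = n)
    {ε d : ℝ} (hε : 0 ≤ ε) (hd0 : 0 ≤ d)
    (hreg : ∀ S, (Γ.bigraph S).IsEpsRegular ε) (hd : ∀ S, (Γ.bigraph S).density ≤ d + ε)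
    {Φ Ψ : Type*} [Fintype Φ] [Fintype Ψ] (φ : V → Φ) (ψ : V → Ψ) (q : V → V → Fin ℓ)
    (g : Φ → Ψ → Fin ℓ → Finset (Fin K)) :
    (#{p ∈ Γ.A ×ˢ Γ.B | ∃ S, p ∈ Γ.P S ∧
        10 * #(symmDiff (g (φ p.1) (ψ p.2) (q p.1 p.2)) S) ≤ K} : ℝ) ≤
      ℓ * smallSubsets K *
        ((d + 2 * ε) * (n : ℝ) ^ 2 + Fintype.card Φ * Fintype.card Ψ * (ε * (n : ℝ) ^ 2)) := by
  have hball : ∀ S₀ : Finset (Fin K),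
      #{S : Finset (Fin K) | 10 * #(symmDiff S₀ S) ≤ K} = smallSubsets K := by
    intro S₀
    refine card_bij' (fun S _ => symmDiff S₀ S) (fun S _ => symmDiff S₀ S) ?_ ?_ ?_ ?_
    · intro S hS; simpa using hS
    · intro S hS; simpa using hS
    · intro S _; simp
    · intro S _; simp
  set A : Φ → Finset V := fun f => {x ∈ Γ.A | φ x = f} with hAf
  set B : Ψ → Finset V := fun f => {x ∈ Γ.B | ψ x = f} with hBf
  have sA : ∑ f, (#(A f) : ℝ) = n := by
    rw [← hA, card_eq_sum_card_fiberwise (f := φ) (t := univ) (fun _ _ => mem_coe.2 (mem_univ _))]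
    push_cast; rfl
  have sB : ∑ f, (#(B f) : ℝ) = n := by
    rw [← hB, card_eq_sum_card_fiberwise (f := ψ) (t := univ) (fun _ _ => mem_coe.2 (mem_univ _))]
    push_cast; rfl
  have hsub : {p ∈ Γ.A ×ˢ Γ.B | ∃ S, p ∈ Γ.P S ∧
        10 * #(symmDiff (g (φ p.1) (ψ p.2) (q p.1 p.2)) S) ≤ K} ⊆
      (univ : Finset (Φ × Ψ × Fin ℓ)).biUnion fun r =>
        ({S : Finset (Fin K) | 10 * #(symmDiff (g r.1 r.2.1 r.2.2) S) ≤ K} : Finset _).biUnion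
          fun S => Γ.P S ∩ A r.1 ×ˢ B r.2.1 := by
    rintro ⟨x, y⟩ hp
    simp only [mem_filter, mem_product] at hp
    obtain ⟨⟨hx, hy⟩, S, hS, hK⟩ := hp
    simp only [mem_biUnion, mem_univ, true_and, mem_filter, mem_inter, mem_product, hAf, hBf]
    exact ⟨(φ x, ψ y, q x y), S, hK, hS, ⟨hx, rfl⟩, hy, rfl⟩
  have hloc : ∀ r : Φ × Ψ × Fin ℓ,
      (#(({S : Finset (Fin K) | 10 * #(symmDiff (g r.1 r.2.1 r.2.2) S) ≤ K} : Finset _).biUnion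
          fun S => Γ.P S ∩ A r.1 ×ˢ B r.2.1) : ℝ) ≤
      smallSubsets K * ((d + 2 * ε) * (#(A r.1) * #(B r.2.1)) + ε * (n : ℝ) ^ 2) := by
    intro r
    refine (Nat.cast_le.2 card_biUnion_le).trans ?_
    rw [Nat.cast_sum, ← hball (g r.1 r.2.1 r.2.2), ← nsmul_eq_mul]
    refine sum_le_card_nsmul _ _ _ fun S _ => ?_
    have := (hreg S).card_inter_le (hd S) hε hd0 (X := A r.1) (Y := B r.2.1)
      (filter_subset _ _) (filter_subset _ _)
    change (#(Γ.P S ∩ A r.1 ×ˢ B r.2.1) : ℝ) ≤ _ + ε * (#Γ.A * #Γ.B) at this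
    rw [hA, hB] at this
    rwa [sq]
  refine (Nat.cast_le.2 ((card_le_card hsub).trans card_biUnion_le)).trans ?_
  rw [Nat.cast_sum]
  refine (sum_le_sum fun r _ => hloc r).trans_eq ?_
  simp only [Fintype.sum_prod_type, ← Finset.mul_sum, Finset.sum_add_distrib, sum_const, card_univ,
    Fintype.card_fin, nsmul_eq_mul, ← Finset.sum_mul, sA, sB, Fintype.card_prod, Nat.cast_mul]
  ring

open scoped Classical in
/-- If a set of triples of `A × B × ⋃ C w` is small, then one can choose a vertex in every `C w`
such that the links of the chosen vertices are small on average. -/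
theorem exists_transversal_sum_le {V κ : Type*} [DecidableEq V] [Fintype κ] {m : ℕ} (hm : 0 < m)
    (A B : Finset V) (C : κ → Finset V) (hC : ∀ w, #(C w) = m)
    (hdisj : ∀ w w', w ≠ w' → Disjoint (C w) (C w')) (bad : V → V → V → Prop) :
    ∃ z : κ → V, (∀ w, z w ∈ C w) ∧
      m * ∑ w, #{p ∈ A ×ˢ B | bad p.1 p.2 (z w)} ≤
        #{p ∈ A ×ˢ B ×ˢ univ.biUnion C | bad p.1 p.2.1 p.2.2} := by
  have h : ∀ w, ∃ z ∈ C w, m * #{p ∈ A ×ˢ B | bad p.1 p.2 z} ≤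
      ∑ z' ∈ C w, #{p ∈ A ×ˢ B | bad p.1 p.2 z'} := by
    intro w
    obtain ⟨z, hz, hmin⟩ := exists_min_image (C w) (fun z => #{p ∈ A ×ˢ B | bad p.1 p.2 z})
      (card_pos.1 (by rw [hC]; exact hm))
    refine ⟨z, hz, ?_⟩
    rw [← hC w, ← smul_eq_mul]
    exact card_nsmul_le_sum _ _ _ hmin
  choose z hz hle using h
  refine ⟨z, hz, ?_⟩
  rw [Finset.mul_sum]
  refine (sum_le_sum fun w _ => hle w).trans_eq ?_
  rw [← sum_biUnion fun w _ w' _ hww => hdisj w w' hww]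
  rw [card_eq_sum_card_fiberwise (f := fun p : V × V × V => p.2.2) (t := univ.biUnion C)]
  · refine sum_congr rfl fun z hz => ?_
    refine card_bij (fun p _ => (p.1, p.2, z)) ?_ ?_ ?_
    · rintro ⟨x, y⟩ hp
      simp only [mem_filter, mem_product] at hp ⊢
      exact ⟨⟨⟨hp.1.1, hp.1.2, hz⟩, hp.2⟩, trivial⟩
    · rintro ⟨x, y⟩ _ ⟨x', y'⟩ _ h
      simpa using h
    · rintro ⟨x, y, z'⟩ hp
      simp only [mem_filter, mem_product] at hp
      obtain ⟨⟨⟨hx, hy, -⟩, hb⟩, rfl⟩ := hp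
      exact ⟨(x, y), by simp [hx, hy, hb], rfl⟩
  · intro p hp
    exact (mem_product.1 (mem_product.1 (mem_filter.1 (mem_coe.1 hp)).1).2).2

open scoped Classical in
/-- Markov's inequality for a finite family of sets: if the average size of the sets is at most
`#s / 20`, then at least half of the points lie in at most a tenth of the sets. -/
theorem card_le_two_mul_card_rarely_bad {ι : Type*} {K : ℕ} (hK : 0 < K) (s : Finset ι)
    (bad : ι → Fin K → Prop) (h : 20 * ∑ w, #{p ∈ s | bad p w} ≤ K * #s) :
    #s ≤ 2 * #{p ∈ s | 10 * #{w | bad p w} ≤ K} := by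
  have h1 : ∑ w, #{p ∈ s | bad p w} = ∑ p ∈ s, #{w | bad p w} := by
    simp only [card_filter]
    exact Finset.sum_comm
  have h2 : #{p ∈ s | ¬ 10 * #{w | bad p w} ≤ K} * K ≤
      ∑ p ∈ s, 10 * #{w | bad p w} := by
    rw [← smul_eq_mul]
    refine (card_nsmul_le_sum _ (fun p => 10 * #{w | bad p w}) _ fun p hp => ?_).trans
      (sum_le_sum_of_subset (filter_subset _ _))
    exact (not_le.1 (mem_filter.1 hp).2).le
  have h3 := card_filter_add_card_filter_not (s := s) fun p => 10 * #{w | bad p w} ≤ K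
  rw [← Finset.mul_sum, ← h1] at h2
  have h4 : 2 * #{p ∈ s | ¬ 10 * #{w | bad p w} ≤ K} ≤ #s := by
    refine le_of_mul_le_mul_left ?_ hK
    calc K * (2 * #{p ∈ s | ¬ 10 * #{w | bad p w} ≤ K})
        = 2 * (#{p ∈ s | ¬ 10 * #{w | bad p w} ≤ K} * K) := by ring
      _ ≤ 2 * (10 * ∑ w, #{p ∈ s | bad p w}) := by gcongr
      _ = 20 * ∑ w, #{p ∈ s | bad p w} := by ring
      _ ≤ K * #s := h
  omega

/-! ### The lower bound on the number of pieces -/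

open scoped Classical in
/-- The combinatorial core: a regular decomposition of a blowup needs so many pieces per pair of
classes that `ℓ` Hamming balls of radius `K / 10` cover a quarter of the cube `𝒫([K])`. -/
theorem two_pow_le_mul_smallSubsets {V : Type*} [Fintype V] [DecidableEq V] {K m n t ℓ : ℕ}
    (hK : 0 < K) (hn : 0 < n) (hKm : K * m = n)
    (Γ : ColoredBipartite V (powersetBigraph K).left) (hA : #Γ.A = n) (hB : #Γ.B = n)
    {ε ε₁ ε₂ η σ : ℝ} (hε : 0 ≤ ε) (hreg : ∀ S, (Γ.bigraph S).IsEpsRegular ε)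
    (hd : ∀ S, (Γ.bigraph S).density ≤ ((2 : ℝ) ^ K)⁻¹ + ε)
    (hεM : (2 + ((t : ℝ) * ℓ ^ K) ^ 2) * ε ≤ ((2 : ℝ) ^ K)⁻¹)
    (H : ThreeGraph V) (hH : IsBlowup (powersetBigraph K) m Γ H)
    (P : Decomposition V t ℓ) (hP : P.IsRegular H ε₁ ε₂)
    (hε₁ : 0 ≤ ε₁) (hε₁' : ε₁ ≤ 1 / 10 ^ 4) (hη : 0 ≤ η) (hη' : 2 ^ 20 * ε₁ ≤ η ^ 8)
    (hKη : K * η ≤ 1 / 10 ^ 4) (hσ : 0 ≤ σ) (hσ' : ℓ * σ ≤ 1 / 10 ^ 4) (hε₂ : ε₂ ≤ σ ^ 4) :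
    (2 : ℝ) ^ K ≤ 4 * (ℓ * smallSubsets K) := by
  have hm : 0 < m := Nat.pos_of_ne_zero fun h => by simp [h] at hKm; omega
  obtain ⟨C, hCm, hCdisj, -, hcover, hedge⟩ := hH
  have hCm' : ∀ w, #(C w) = m := fun w => hCm w (mem_univ _)
  have hCdisj' : ∀ w w', w ≠ w' → Disjoint (C w) (C w') :=
    fun w w' h => hCdisj w (mem_univ _) w' (mem_univ _) h
  -- the color of a pair
  have hcol : ∀ x y, ∃ S : Finset (Fin K), x ∈ Γ.A → y ∈ Γ.B → (x, y) ∈ Γ.P S := by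
    intro x y
    by_cases h : (x, y) ∈ Γ.A ×ˢ Γ.B
    · have h' := h
      rw [← Γ.P_cover, mem_biUnion] at h'
      obtain ⟨S, -, hS⟩ := h'
      exact ⟨S, fun _ _ => hS⟩
    · exact ⟨∅, fun hx hy => absurd (mk_mem_product hx hy) h⟩
  choose S hS using hcol
  have hN : ∀ w, ∀ x ∈ Γ.A, ∀ y ∈ Γ.B, ∀ z ∈ C w,
      (x, y, z) ∈ H.toTrigraph.edges ↔ w ∈ S x y := by
    intro w x hx y hy z hz
    have h := hedge (S x y) (mem_univ _) w (mem_univ _) x y z (hS x y hx hy) hz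
    simpa [ThreeGraph.toTrigraph, powersetBigraph] using h
  have hV : (Fintype.card V : ℝ) ≤ 3 * n := by
    have h1 : #(univ.biUnion C) ≤ n := by
      refine card_biUnion_le.trans_eq ?_
      simp [hCm', hKm]
    have h2 : Fintype.card V ≤ 3 * n := by
      rw [← card_univ, ← hcover]
      refine (card_union_le _ _).trans ?_
      have := card_union_le Γ.A Γ.B
      change _ + #(univ.biUnion C) ≤ _
      omega
    exact_mod_cast h2
  set bad : V → V → V → Prop := P.IsBadTriple H ε₁ ε₂ σ
  have hbadc : (#{p ∈ Γ.A ×ˢ Γ.B ×ˢ univ.biUnion C | bad p.1 p.2.1 p.2.2} : ℝ) ≤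
      1 / 20 * (n : ℝ) ^ 3 := by
    refine (P.card_bad_le H hε₁ hη hη' hσ hε₂ hP Γ.A Γ.B C (fun w x y => w ∈ S x y) hN).trans ?_
    rw [Fintype.card_fin]
    calc (ε₁ + 3 * (ℓ * σ) + 2 * (K * η)) * (Fintype.card V : ℝ) ^ 3
        ≤ (1 / 10 ^ 4 + 3 * (1 / 10 ^ 4) + 2 * (1 / 10 ^ 4)) * (3 * n : ℝ) ^ 3 := by gcongr
      _ = (162 / 10 ^ 4) * (n : ℝ) ^ 3 := by ring
      _ ≤ 1 / 20 * (n : ℝ) ^ 3 := by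
          refine mul_le_mul_of_nonneg_right ?_ (by positivity)
          norm_num
  obtain ⟨z, hzC, hz⟩ := exists_transversal_sum_le hm Γ.A Γ.B C hCm' hCdisj' bad
  have havg : 20 * ∑ w, #{p ∈ Γ.A ×ˢ Γ.B | bad p.1 p.2 (z w)} ≤ K * #(Γ.A ×ˢ Γ.B) := by
    have h1 : 20 * #{p ∈ Γ.A ×ˢ Γ.B ×ˢ univ.biUnion C | bad p.1 p.2.1 p.2.2} ≤ n ^ 3 := by
      have : (20 : ℝ) * #{p ∈ Γ.A ×ˢ Γ.B ×ˢ univ.biUnion C | bad p.1 p.2.1 p.2.2} ≤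
        (n : ℝ) ^ 3 := by linarith
      exact_mod_cast this
    refine le_of_mul_le_mul_left ?_ hm
    rw [card_product, hA, hB]
    calc m * (20 * ∑ w, #{p ∈ Γ.A ×ˢ Γ.B | bad p.1 p.2 (z w)})
        = 20 * (m * ∑ w, #{p ∈ Γ.A ×ˢ Γ.B | bad p.1 p.2 (z w)}) := by ring
      _ ≤ n ^ 3 := (Nat.mul_le_mul_left 20 hz).trans h1
      _ = (K * m) * (n * n) := by rw [hKm]; ring
      _ = m * (K * (n * n)) := by ring
  have hhalf := card_le_two_mul_card_rarely_bad hK (Γ.A ×ˢ Γ.B)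
    (fun p w => bad p.1 p.2 (z w)) havg
  -- the guess for the color of `(x, y)` reads off the predictions of the triads of `(x, y, z w)`
  set g : Fin t × (Fin K → Fin ℓ) → Fin t × (Fin K → Fin ℓ) → Fin ℓ → Finset (Fin K) :=
    fun f f' a => {w | 1 / 2 ≤
      (H.toTrigraph.restrict (P.triad f.1 f'.1 (P.classIndex (z w)) a (f.2 w) (f'.2 w))).relDensity
        (P.triad f.1 f'.1 (P.classIndex (z w)) a (f.2 w) (f'.2 w))} with hg
  have hclose := card_close_to_guess_le Γ hA hB hε (by positivity) hreg hd
    (fun x => (P.classIndex x, fun w => P.pieceIndex x (z w)))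
    (fun y => (P.classIndex y, fun w => P.pieceIndex y (z w))) P.pieceIndex g
  have hsub : {p ∈ Γ.A ×ˢ Γ.B | 10 * #{w | bad p.1 p.2 (z w)} ≤ K} ⊆
      {p ∈ Γ.A ×ˢ Γ.B | ∃ S, p ∈ Γ.P S ∧
        10 * #(symmDiff (g (P.classIndex p.1, fun w => P.pieceIndex p.1 (z w))
          (P.classIndex p.2, fun w => P.pieceIndex p.2 (z w)) (P.pieceIndex p.1 p.2)) S) ≤ K} := by
    rintro ⟨x, y⟩ hp
    simp only [mem_filter] at hp ⊢
    obtain ⟨hxy, hb⟩ := hp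
    obtain ⟨hx, hy⟩ := mem_product.1 hxy
    refine ⟨hxy, S x y, hS x y hx hy, le_trans (Nat.mul_le_mul_left 10 (card_le_card ?_)) hb⟩
    intro w hw
    rw [mem_filter]
    refine ⟨mem_univ _, Or.inr ?_⟩
    have h1 := hN w x hx y hy (z w) (hzC w)
    have h2 : w ∈ g (P.classIndex x, fun w => P.pieceIndex x (z w))
          (P.classIndex y, fun w => P.pieceIndex y (z w)) (P.pieceIndex x y) ↔
        1 / 2 ≤ (H.toTrigraph.restrict (P.tripleTriad x y (z w))).relDensity
          (P.tripleTriad x y (z w)) := by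
      rw [hg, mem_filter]
      exact and_iff_right (mem_univ _)
    rw [mem_symmDiff, h2, ← h1] at hw
    unfold Decomposition.IsMispredicted
    tauto
  have hcount : (n : ℝ) ^ 2 ≤ 2 * (ℓ * smallSubsets K *
      ((((2 : ℝ) ^ K)⁻¹ + 2 * ε) * (n : ℝ) ^ 2 + (t * ℓ ^ K) * (t * ℓ ^ K) * (ε * (n : ℝ) ^ 2))) := by
    have h1 : ((n * n : ℕ) : ℝ) ≤ 2 * #{p ∈ Γ.A ×ˢ Γ.B | 10 * #{w | bad p.1 p.2 (z w)} ≤ K} := by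
      rw [card_product, hA, hB] at hhalf
      exact_mod_cast hhalf
    have h2 := (Nat.cast_le (α := ℝ)).2 (card_le_card hsub)
    have h3 := h2.trans hclose
    simp only [Fintype.card_prod, Fintype.card_fin, Fintype.card_fun, Nat.cast_mul,
      Nat.cast_pow] at h3
    push_cast at h1
    linarith
  have hn2 : 0 < (n : ℝ) ^ 2 := by positivity
  have h4 : (ℓ * smallSubsets K : ℝ) *
      ((((2 : ℝ) ^ K)⁻¹ + 2 * ε) + (t * ℓ ^ K) * (t * ℓ ^ K) * ε) ≤
      (ℓ * smallSubsets K : ℝ) * (2 * ((2 : ℝ) ^ K)⁻¹) := by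
    refine mul_le_mul_of_nonneg_left ?_ (by positivity)
    linarith
  have h5 : (1 : ℝ) ≤ 2 * ((ℓ * smallSubsets K : ℝ) * (2 * ((2 : ℝ) ^ K)⁻¹)) := by
    refine le_of_mul_le_mul_right ?_ hn2
    nlinarith [mul_le_mul_of_nonneg_right h4 hn2.le]
  have h6 : 2 * ((ℓ * smallSubsets K : ℝ) * (2 * ((2 : ℝ) ^ K)⁻¹)) =
      4 * (ℓ * smallSubsets K) / 2 ^ K := by
    rw [div_eq_mul_inv]; ring
  rw [h6, le_div_iff₀ (by positivity)] at h5
  linarith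

/-- The numerical consequence of `two_pow_le_mul_smallSubsets`. -/
theorem two_rpow_sqrt_le {D : ℝ} (hD : 10 ^ 4 ≤ D) {ℓ : ℕ}
    (h : (2 : ℝ) ^ ⌊D⌋₊ ≤ 4 * (ℓ * smallSubsets ⌊D⌋₊)) : (2 : ℝ) ^ √D ≤ ℓ := by
  by_contra! hlt
  set K := ⌊D⌋₊ with hK
  have hKD : D < K + 1 := Nat.lt_floor_add_one D
  have hs : √D ≤ D / 100 := by
    rw [Real.sqrt_le_left (by linarith)]
    nlinarith
  have h1 : (2 : ℝ) ^ (10 * K) ≤ 2 ^ (7 * K) * (2 ^ 20 * (ℓ : ℝ) ^ 10) := by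
    calc (2 : ℝ) ^ (10 * K) = (2 ^ K) ^ 10 := by rw [← pow_mul, mul_comm]
      _ ≤ (4 * (ℓ * smallSubsets K)) ^ 10 := by gcongr
      _ = (smallSubsets K : ℝ) ^ 10 * (2 ^ 20 * (ℓ : ℝ) ^ 10) := by ring
      _ ≤ _ := by gcongr; exact smallSubsets_pow_le K
  have h2 : (2 : ℝ) ^ (3 * K) ≤ 2 ^ 20 * (ℓ : ℝ) ^ 10 := by
    refine le_of_mul_le_mul_left ?_ (pow_pos (two_pos (α := ℝ)) (7 * K))
    rw [← pow_add, ← add_mul]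
    exact h1
  have h3 : (ℓ : ℝ) ^ 10 ≤ (2 : ℝ) ^ (10 * √D) := by
    have h10 : (2 : ℝ) ^ (10 * √D) = ((2 : ℝ) ^ √D) ^ 10 := by
      rw [mul_comm, Real.rpow_mul (by norm_num)]
      exact Real.rpow_natCast _ 10
    rw [h10]
    gcongr
  have h4 : (2 : ℝ) ^ ((3 * K : ℕ) : ℝ) ≤ (2 : ℝ) ^ ((20 : ℝ) + 10 * √D) := by
    rw [Real.rpow_natCast, Real.rpow_add (by norm_num)]
    refine h2.trans (mul_le_mul ?_ h3 (by positivity) (by positivity))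
    norm_num
  rw [Real.rpow_le_rpow_left_iff (by norm_num)] at h4
  push_cast at h4
  linarith

end HypergraphRegularity

open HypergraphRegularity in
theorem mainTheorem8 :
    ∃ K₁ εstar : ℝ, 0 < K₁ ∧ 0 < εstar ∧
      ∀ ε₁ : ℝ, 0 < ε₁ → ε₁ < εstar ^ (K₁ ^ 2) →
      ∃ ε₂star : ℕ → ℝ, (∀ x, 0 < ε₂star x ∧ ε₂star x < 1) ∧
      ∀ t : ℕ, 1 ≤ t →
      ∀ ε₂ : ℕ → ℝ, (∀ x, 0 < ε₂ x ∧ ε₂ x < 1 ∧ ε₂ x < ε₂star x) →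
      ∃ ε : ℝ, 0 < ε ∧ ∃ N : ℕ, ∀ n : ℕ, N ≤ n →
      ∀ K : ℕ, K = ⌊ε₁ ^ (-(1 / K₁ ^ 2))⌋₊ →
      ∀ m : ℕ, K * m = n →
      ∀ (V : Type*) [Fintype V] [DecidableEq V]
        (Γ : ColoredBipartite V (powersetBigraph K).left),
        Γ.A.card = n → Γ.B.card = n →
        (∀ S : Finset (Fin K), (Γ.bigraph S).IsEpsRegular ε ∧
          |(Γ.bigraph S).density - ((2 : ℝ) ^ K)⁻¹| ≤ ε) →
      ∀ H : ThreeGraph V, IsBlowup (powersetBigraph K) m Γ H →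
      ∀ ℓ : ℕ, 1 ≤ ℓ → ∀ P : Decomposition V t ℓ,
        P.IsQuasirandom (ε₁ ^ K₁) (ε₂ ℓ ^ K₁) →
        P.IsRegular H (ε₁ ^ K₁) (ε₂ ℓ ^ K₁) →
        (2 : ℝ) ^ (ε₁ ^ (-(1 / (2 * K₁ ^ 2)))) ≤ (ℓ : ℝ) := by
  refine ⟨3, 1 / 10 ^ 4, by norm_num, by norm_num, fun ε₁ hε₁ hlt => ?_⟩
  -- everything is expressed through `D = 1 / δ`, where `ε₁ = δ ^ 9`
  obtain ⟨D, hD0, hDε⟩ : ∃ D : ℝ, 0 < D ∧ ε₁ = D⁻¹ ^ 9 := by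
    refine ⟨(ε₁ ^ ((9 : ℕ) : ℝ)⁻¹)⁻¹, by positivity, ?_⟩
    rw [inv_inv, Real.rpow_inv_natCast_pow hε₁.le (by norm_num)]
  have hD : 10 ^ 4 ≤ D := by
    have h9 : ((3 : ℝ) ^ 2) = ((9 : ℕ) : ℝ) := by norm_num
    rw [h9, Real.rpow_natCast, hDε] at hlt
    have h := lt_of_pow_lt_pow_left₀ 9 (by norm_num) hlt
    rw [one_div] at h
    exact ((inv_lt_inv₀ hD0 (by norm_num)).1 h).le
  have hK1 : ε₁ ^ (-(1 / (3 : ℝ) ^ 2)) = D := by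
    rw [hDε, ← Real.rpow_natCast, ← Real.rpow_mul (by positivity), Real.inv_rpow hD0.le,
      ← Real.rpow_neg hD0.le]
    norm_num
  have hK2 : ε₁ ^ (-(1 / (2 * (3 : ℝ) ^ 2))) = √D := by
    rw [hDε, ← Real.rpow_natCast, ← Real.rpow_mul (by positivity), Real.inv_rpow hD0.le,
      ← Real.rpow_neg hD0.le, Real.sqrt_eq_rpow]
    norm_num
  have hDinv : D⁻¹ ≤ 1 / 10 ^ 4 := by
    rw [one_div]
    exact inv_anti₀ (by norm_num) hD
  have hε3 : ε₁ ^ (3 : ℝ) = D⁻¹ ^ 27 := by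
    have : (3 : ℝ) = ((3 : ℕ) : ℝ) := by norm_num
    rw [this, Real.rpow_natCast, hDε, ← pow_mul]
  have hDinv0 : 0 < D⁻¹ := by positivity
  refine ⟨fun ℓ => (1 / (10 ^ 4 * (ℓ + 1))) ^ 4, fun ℓ => ⟨by positivity, ?_⟩, ?_⟩
  · refine pow_lt_one₀ (by positivity) ?_ (by norm_num)
    rw [div_lt_one (by positivity)]
    have : (0 : ℝ) ≤ ℓ := Nat.cast_nonneg ℓ
    linarith
  intro t _ ε₂ hε₂
  -- only values of `ℓ` below the claimed bound need to be excluded, so `ε` may depend on it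
  set M : ℝ := (2 : ℝ) ^ √D with hM
  have hM0 : 0 < M := by positivity
  refine ⟨((2 : ℝ) ^ ⌊D⌋₊)⁻¹ / (2 + (t * M ^ ⌊D⌋₊) ^ 2), by positivity, 1, ?_⟩
  rw [hK1, hK2, hε3]
  rintro n hn K rfl m hKm V _ _ Γ hA hB hΓ H hH ℓ _ P - hP
  by_contra! hℓ
  refine hℓ.not_ge (two_rpow_sqrt_le hD ?_)
  have hKpos : 0 < ⌊D⌋₊ := Nat.floor_pos.2 (by linarith)
  refine two_pow_le_mul_smallSubsets (η := D⁻¹ / 10 ^ 4) (σ := 1 / (10 ^ 4 * (ℓ + 1))) hKpos hn hKm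
    Γ hA hB ?_ (fun S => (hΓ S).1) (fun S => ?_) ?_ H hH P hP (by positivity) ?_ (by positivity)
    ?_ ?_ (by positivity) ?_ ?_
  · positivity
  · linarith [(abs_le.1 (hΓ S).2).2]
  · have hpos : 0 < 2 + (t * M ^ ⌊D⌋₊) ^ 2 := by positivity
    rw [mul_div_assoc', div_le_iff₀ hpos, mul_comm]
    gcongr
  · calc D⁻¹ ^ 27 ≤ D⁻¹ ^ 1 := pow_le_pow_of_le_one hDinv0.le (by linarith) (by norm_num)
      _ ≤ 1 / 10 ^ 4 := by rwa [pow_one]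
  · calc 2 ^ 20 * D⁻¹ ^ 27 = 2 ^ 20 * D⁻¹ ^ 8 * D⁻¹ ^ 19 := by ring
      _ ≤ 2 ^ 20 * D⁻¹ ^ 8 * (1 / 10 ^ 4) ^ 19 := by gcongr
      _ = D⁻¹ ^ 8 * (2 ^ 20 * (1 / 10 ^ 4) ^ 19) := by ring
      _ ≤ D⁻¹ ^ 8 * (1 / 10 ^ 4) ^ 8 := by
        refine mul_le_mul_of_nonneg_left ?_ (by positivity)
        norm_num
      _ = (D⁻¹ / 10 ^ 4) ^ 8 := by ring
  · calc (⌊D⌋₊ : ℝ) * (D⁻¹ / 10 ^ 4) ≤ D * (D⁻¹ / 10 ^ 4) := by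
          gcongr
          exact Nat.floor_le hD0.le
      _ = 1 / 10 ^ 4 := by field_simp
  · rw [mul_one_div, div_le_div_iff₀ (by positivity) (by norm_num)]
    linarith
  · obtain ⟨h0, h1, h2⟩ := hε₂ ℓ
    calc ε₂ ℓ ^ (3 : ℝ) ≤ ε₂ ℓ ^ (1 : ℝ) :=
          Real.rpow_le_rpow_of_exponent_ge h0 h1.le (by norm_num)
      _ = ε₂ ℓ := Real.rpow_one _
      _ ≤ _ := h2.le
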